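/- A recursive tree of size $n\ge 1$ is a rooted tree with vertices labeled $1,\dots,n$, rooted at the vertex $1$, whose labels increase along the branches starting from the root; let $\mathbb T_n$ be a uniform random recursive tree of size $n$. In the parking process on a rooted tree, cars arrive at the vertices; each car parks at its arrival vertex if that vertex is empty, and otherwise drives towards the root until it finds an empty vertex, where it parks; if it finds none, it exits the tree through the root. The number of cars that exit does not depend on the order in which the cars arrive. For a probability measure $\mu$ on $\{0,1,2,\dots\}$, the flux $\varphi(\mathbb T_n,\mu)$ is the number of cars that exit $\mathbb T_n$ when, conditionally on $\mathbb T_n$, the numbers of cars arriving at its vertices are i.i.d. with law $\mu$. For $\alpha\in[0,1]$ let $\mu_\alpha=(1-\alpha/2)\,\delta_0+(\alpha/2)\,\delta_2$. Theorem. Let $\delta>0$ and let $(\alpha_n)_{n\ge1}$ be a sequence in $[0,1]$. (i) If $\alpha_n\ll\log(n)^{-2}$, then $\varphi(\mathbb T_n,\mu_{\alpha_n})\to0$ in probability as $n\to\infty$. (ii) If $\alpha_n\gg\log(n)^{-2+\delta}$, then $\varphi(\mathbb T_n,\mu_{\alpha_n})\to+\infty$ in probability as $n\to\infty$, that is, $\mathbb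 P(\varphi(\mathbb T_n,\mu_{\alpha_n})\ge C)\to1$ for every $C\in\mathbb R$. Here $u_n\ll v_n$, or equivalently $v_n\gg u_n$, means that $v_n\ne0$ for all large $n$ and $u_n/v_n\to0$ as $n\to\infty$. -/

import Mathlib

open Filter Topology MeasureTheory ProbabilityTheory Asymptotics

namespace RecursiveParking

/-- A recursive tree with `n` vertices. The label `i + 1` is represented by `i : Fin n`, so that the
root is the vertex `0`; the tree is given by the parent of every non-root vertex, and labels increase
along the branches, which means that the parent of a vertex is smaller than the vertex. -/
def RecursiveTree (n : ℕ) : Type :=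
  (v : {v : Fin n // v.val ≠ 0}) → {u : Fin n // u < v.val}

instance (n : ℕ) : Fintype (RecursiveTree n) :=
  inferInstanceAs (Fintype ((v : {v : Fin n // v.val ≠ 0}) → {u : Fin n // u < v.val}))

instance (n : ℕ) : MeasurableSpace (RecursiveTree n) := ⊤

instance (n : ℕ) : DiscreteMeasurableSpace (RecursiveTree n) := ⟨fun _ => trivial⟩

variable {n : ℕ}

/-- The parent of a vertex `v` different from the root. -/
def RecursiveTree.parent (t : RecursiveTree n) (v : Fin n) (hv : v.val ≠ 0) : Fin n :=
  (t ⟨v, hv⟩).val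

theorem RecursiveTree.parent_lt (t : RecursiveTree n) (v : Fin n) (hv : v.val ≠ 0) :
    t.parent v hv < v :=
  (t ⟨v, hv⟩).property

/-- The place where a car that arrives at `v` parks if the vertices of `S` are occupied: the car
takes `v` if `v` is empty, and otherwise drives on to the parent of `v`, and so on. The value is
`none` if no vertex from `v` to the root is empty: then the car exits the tree through the root. -/
def parkingSpot (t : RecursiveTree n) (S : Finset (Fin n)) (v : Fin n) : Option (Fin n) :=
  if v ∉ S then some v
  else if hv : v.val = 0 then none
  else parkingSpot t S (t.parent v hv)
termination_by v.val
decreasing_by exact t.parent_lt v hv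

/-- The set of occupied vertices and the number of cars that have exited the tree. -/
structure ParkingState (n : ℕ) where
  occupied : Finset (Fin n)
  exited : ℕ

/-- The effect of one car that arrives at `v`. -/
def parkCar (t : RecursiveTree n) (s : ParkingState n) (v : Fin n) : ParkingState n :=
  match parkingSpot t s.occupied v with
  | some w => ⟨insert w s.occupied, s.exited⟩
  | none => ⟨s.occupied, s.exited + 1⟩

theorem parkingSpot_insert_of_ne (t : RecursiveTree n) (S : Finset (Fin n)) (w v : Fin n)
    (h : parkingSpot t S v ≠ some w) : parkingSpot t (insert w S) v = parkingSpot t S v := by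
  induction hk : v.val using Nat.strong_induction_on generalizing v with
  | _ k ih =>
    subst hk
    rw [parkingSpot] at h ⊢
    conv_rhs => rw [parkingSpot]
    by_cases hv : v ∈ S
    · by_cases h0 : v.val = 0
      · simp [hv, h0]
      · simp only [hv, h0, not_true_eq_false, if_false, dif_neg, not_false_eq_true,
          Finset.mem_insert, or_true] at h ⊢
        exact ih _ (t.parent_lt v h0) _ h rfl
    · have : v ≠ w := by rintro rfl; simp [hv] at h
      simp [hv, this]

theorem parkingSpot_insert_of_eq (t : RecursiveTree n) (S : Finset (Fin n)) (w v : Fin n)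
    (h : parkingSpot t S v = some w) :
    parkingSpot t (insert w S) v = parkingSpot t (insert w S) w := by
  induction hk : v.val using Nat.strong_induction_on generalizing v with
  | _ k ih =>
    subst hk
    rw [parkingSpot] at h
    by_cases hv : v ∈ S
    · by_cases h0 : v.val = 0
      · simp [hv, h0] at h
      · simp only [hv, h0, not_true_eq_false, if_false, dif_neg, not_false_eq_true] at h
        rw [parkingSpot]
        simp only [hv, h0, not_true_eq_false, if_false, dif_neg, not_false_eq_true,
          Finset.mem_insert, or_true]
        exact ih _ (t.parent_lt v h0) _ h rfl
    · simp only [hv, not_false_eq_true, if_true, Option.some.injEq] at h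
      rw [h]

/-- The order in which two cars arrive does not matter. -/
instance parkCar_rightCommutative (t : RecursiveTree n) : RightCommutative (parkCar t) where
  right_comm s u v := by
    rcases hu : parkingSpot t s.occupied u with _ | a <;>
      rcases hv : parkingSpot t s.occupied v with _ | b
    · simp [parkCar, hu, hv]
    · have h := parkingSpot_insert_of_ne t s.occupied b u (by simp [hu])
      simp [parkCar, hu, hv, h]
    · have h := parkingSpot_insert_of_ne t s.occupied a v (by simp [hv])
      simp [parkCar, hu, hv, h]
    · by_cases hab : a = b
      · subst hab
        have h1 := parkingSpot_insert_of_eq t s.occupied a u hu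
        have h2 := parkingSpot_insert_of_eq t s.occupied a v hv
        simp [parkCar, hu, hv, h1, h2]
      · have h1 := parkingSpot_insert_of_ne t s.occupied a v (by simpa [hv] using Ne.symm hab)
        have h2 := parkingSpot_insert_of_ne t s.occupied b u (by simpa [hu] using hab)
        simp [parkCar, hu, hv, h1, h2, Finset.insert_comm]

/-- The flux: the number of cars that exit the tree `t` when, for every vertex `v`, `a v` cars arrive
at `v` in an initially empty tree. -/
def flux (t : RecursiveTree n) (a : Fin n → ℕ) : ℕ :=
  ((∑ v, Multiset.replicate (a v) v).foldl (parkCar t) ⟨∅, 0⟩).exited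

/-- The binary car arrival law `(1 - α / 2) δ₀ + (α / 2) δ₂`. -/
noncomputable def binaryLaw (α : ℝ) : Measure ℕ :=
  ENNReal.ofReal (1 - α / 2) • Measure.dirac 0 + ENNReal.ofReal (α / 2) • Measure.dirac 2

/-- The joint law of a uniform recursive tree with `n` vertices and of car arrivals on its vertices
which, conditionally on the tree, are independent with common law `μ`. -/
noncomputable def parkingLaw (n : ℕ) (μ : Measure ℕ) :
    Measure (RecursiveTree n × (Fin n → ℕ)) :=
  (uniformOn (Set.univ : Set (RecursiveTree n))).prod (Measure.pi fun _ => μ)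

end RecursiveParking

/-!
Let `X` be the number of cars that visit the root of a uniform recursive tree, so that the flux is
`X - 1` in truncated subtraction, and let two cars arrive at every vertex with probability `p = α / 2`.

*Splitting.* Cutting the edge between the first two vertices leaves two independent uniform recursive
trees, and the size of the second one is uniform, so that `X` is distributed as `X' + (X'' - 1)` with
independent `X'` and `X''` that belong to trees of random complementary sizes. To obtain this without
relabelling, a recursive tree is encoded as a binary tree with the vertices as leaves: `join a b` hangs
`b` under the root of `a`, and a new vertex attached to `v` splits the leaf `v` in two. Uniform recursive
trees become binary trees that grow by splitting uniform leaves, and these satisfy the recursion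
(`treeMean_succ_eq_sum`, `visitMean_succ_eq_sum`). The encoding respects parking, because the last
vertex is a leaf and passes all but one of its cars on to its parent (`flux_eq_flux_init`,
`flux_eq_eval`).

*Few cars.* For `z = log n`, the moment `𝔼 z ^ X` obeys a recursion in which the car that parks at the
root of the second tree costs a factor `z`. It follows that `𝔼 z ^ X - 1` grows only by a factor
`exp (O((log n) / z)) = O(1)` from its initial value, which is at most `p z ^ 2 → 0`
(`visitMean_pow_sub_one_le`).

*Many cars.* The law of `X` increases stochastically with the size of the tree (`antitone_visitMean`).
Let `r` be the probability of `X ≥ 2` in a tree of size `M`. Every larger subtree of the root sends a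
car to the root with probability at least `r`, and there are about `log (n / M)` such subtrees. The
recursion turns this into the drift inequality `visitMean_le_one_sub`. On scales that are powers of `n`,
it shows that two such cars come with probability of order at least `(r log n) ^ 2`, as long as this is
small (`visitTail_two_ge_sq`). Therefore `r` can be replaced by `(r log n) ^ 2`. In terms of
`w = r log(n) ^ 2` this is `w ↦ w ^ 2`, and as `w ≥ log(n) ^ δ` at the start, finitely many steps lead to
a constant `r` (`twoVisitsAtRate_zero`). Then the drift inequality, applied to `2 ^ (-X)`, shows that `X`
tends to infinity in probability (`tendsto_visitMean_half_pow`).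
-/

namespace RecursiveParking

/-! ### Removing the last vertex -/

/-- The recursive tree obtained by removing the vertex with the largest label. -/
def RecursiveTree.init {n : ℕ} (t : RecursiveTree (n + 1)) : RecursiveTree n :=
  fun v => ⟨⟨(t ⟨v.1.castSucc, v.2⟩).1.val,
    lt_trans (t ⟨v.1.castSucc, v.2⟩).2 v.1.isLt⟩, (t ⟨v.1.castSucc, v.2⟩).2⟩

/-- The parent of the vertex with the largest label. -/
def RecursiveTree.lastParent {n : ℕ} (t : RecursiveTree (n + 2)) : Fin (n + 1) :=
  ⟨(t ⟨Fin.last (n + 1), Nat.succ_ne_zero n⟩).1.val,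
    (t ⟨Fin.last (n + 1), Nat.succ_ne_zero n⟩).2⟩

theorem RecursiveTree.castSucc_init_parent {n : ℕ} (t : RecursiveTree (n + 1)) (v : Fin n)
    (hv : v.val ≠ 0) : (t.init.parent v hv).castSucc = t.parent v.castSucc hv := rfl

theorem RecursiveTree.castSucc_lastParent {n : ℕ} (t : RecursiveTree (n + 2)) :
    t.lastParent.castSucc = t.parent (Fin.last (n + 1)) (Nat.succ_ne_zero n) := rfl

/-- A recursive tree is given by the tree without its last vertex and the parent of that vertex. -/
def RecursiveTree.snocEquiv (n : ℕ) :
    RecursiveTree (n + 2) ≃ RecursiveTree (n + 1) × Fin (n + 1) where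
  toFun t := (t.init, t.lastParent)
  invFun q := fun v =>
    if h : v.1.val < n + 1 then
      ⟨(q.1 ⟨⟨v.1.val, h⟩, v.2⟩).1.castSucc, (q.1 ⟨⟨v.1.val, h⟩, v.2⟩).2⟩
    else ⟨q.2.castSucc, lt_of_lt_of_le (b := (⟨n + 1, n.succ.lt_succ_self⟩ : Fin (n + 2)))
      q.2.isLt (Nat.not_lt.mp h)⟩
  left_inv t := by
    funext v
    obtain ⟨v, hv⟩ := v
    induction v using Fin.lastCases with
    | last => exact dif_neg (lt_irrefl (n + 1))
    | cast i => exact dif_pos i.isLt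
  right_inv q := by
    obtain ⟨s, p⟩ := q
    refine Prod.ext ?_ ?_
    · funext v
      refine Subtype.ext (Fin.ext ?_)
      simp only [RecursiveTree.init, Fin.val_castSucc]
      rw [dif_pos v.1.isLt]
      rfl
    · refine Fin.ext ?_
      simp only [RecursiveTree.lastParent, Fin.val_last]
      rw [dif_neg (lt_irrefl (n + 1))]
      rfl

/-- The parking state on the tree without its last vertex. -/
noncomputable def ParkingState.init {n : ℕ} (s : ParkingState (n + 1)) : ParkingState n :=
  ⟨s.occupied.preimage Fin.castSucc (Fin.castSucc_injective n).injOn, s.exited⟩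

theorem parkingSpot_castSucc {n : ℕ} (t : RecursiveTree (n + 1)) (S : Finset (Fin (n + 1)))
    (v : Fin n) :
    parkingSpot t S v.castSucc =
      (parkingSpot t.init (S.preimage Fin.castSucc (Fin.castSucc_injective n).injOn) v).map
        Fin.castSucc := by
  induction hk : v.val using Nat.strong_induction_on generalizing v with
  | _ k ih =>
    subst hk
    rw [parkingSpot]
    conv_rhs => rw [parkingSpot]
    by_cases hv : v.castSucc ∈ S
    · by_cases h0 : v.val = 0
      · simp [hv, h0]
      · simp only [hv, h0, Fin.val_castSucc, Finset.mem_preimage, not_true_eq_false, if_false,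
          dif_neg, not_false_eq_true]
        rw [← ih _ (t.init.parent_lt v h0) _ rfl, t.castSucc_init_parent]
    · simp [hv]

theorem init_parkCar_castSucc {n : ℕ} (t : RecursiveTree (n + 1)) (s : ParkingState (n + 1))
    (v : Fin n) : (parkCar t s v.castSucc).init = parkCar t.init s.init v := by
  unfold parkCar
  rw [parkingSpot_castSucc]
  change _ = match parkingSpot t.init
    (s.occupied.preimage Fin.castSucc (Fin.castSucc_injective n).injOn) v with
    | some w => _
    | none => _
  rcases parkingSpot t.init
    (s.occupied.preimage Fin.castSucc (Fin.castSucc_injective n).injOn) v with _ | w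
  · rfl
  · simp only [Option.map_some, ParkingState.init, ParkingState.mk.injEq, and_true]
    ext u
    simp

theorem parkCar_last_of_mem {n : ℕ} (t : RecursiveTree (n + 2)) (s : ParkingState (n + 2))
    (h : Fin.last (n + 1) ∈ s.occupied) :
    parkCar t s (Fin.last (n + 1)) = parkCar t s t.lastParent.castSucc := by
  unfold parkCar
  have : parkingSpot t s.occupied (Fin.last (n + 1)) =
      parkingSpot t s.occupied t.lastParent.castSucc := by
    conv_lhs => rw [parkingSpot]
    simp [h, t.castSucc_lastParent]
  rw [this]

theorem occupied_subset_parkCar {n : ℕ} (t : RecursiveTree n) (s : ParkingState n) (v : Fin n) :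
    s.occupied ⊆ (parkCar t s v).occupied := by
  unfold parkCar
  split
  · exact Finset.subset_insert _ _
  · exact subset_rfl

theorem init_foldl_castSucc {n : ℕ} (t : RecursiveTree (n + 1)) (m : Multiset (Fin n))
    (s : ParkingState (n + 1)) :
    ((m.map Fin.castSucc).foldl (parkCar t) s).init = m.foldl (parkCar t.init) s.init := by
  induction m using Multiset.induction_on generalizing s with
  | empty => simp
  | cons a m ih => simp [ih, init_parkCar_castSucc]

theorem init_foldl_replicate_last {n : ℕ} (t : RecursiveTree (n + 2)) (k : ℕ)
    (s : ParkingState (n + 2)) (h : Fin.last (n + 1) ∈ s.occupied) :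
    ((Multiset.replicate k (Fin.last (n + 1))).foldl (parkCar t) s).init =
      (Multiset.replicate k t.lastParent).foldl (parkCar t.init) s.init := by
  induction k generalizing s with
  | zero => simp
  | succ k ih =>
    simp only [Multiset.replicate_succ, Multiset.foldl_cons]
    rw [ih _ (occupied_subset_parkCar t s _ h), parkCar_last_of_mem t s h, init_parkCar_castSucc]

/-- The last vertex is a leaf: it keeps one of its cars, and the others continue as if they had
arrived at its parent. -/
theorem flux_eq_flux_init {n : ℕ} (t : RecursiveTree (n + 2)) (a : Fin (n + 2) → ℕ) :
    flux t a = flux t.init (fun i => a i.castSucc +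
      if i = t.lastParent then a (Fin.last (n + 1)) - 1 else 0) := by
  have hsum : (∑ i : Fin (n + 1), Multiset.replicate (a i.castSucc +
      if i = t.lastParent then a (Fin.last (n + 1)) - 1 else 0) i) =
      Multiset.replicate (a (Fin.last (n + 1)) - 1) t.lastParent +
        ∑ i : Fin (n + 1), Multiset.replicate (a i.castSucc) i := by
    simp only [Multiset.replicate_add, Finset.sum_add_distrib]
    refine (add_comm _ _).trans ?_
    congr 1
    rw [Finset.sum_eq_single t.lastParent] <;> simp +contextual
  have hmap : (∑ i : Fin (n + 1), Multiset.replicate (a i.castSucc) i.castSucc) =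
      (∑ i : Fin (n + 1), Multiset.replicate (a i.castSucc) i).map Fin.castSucc := by
    rw [← Multiset.coe_mapAddMonoidHom, map_sum]
    simp
  unfold flux
  rw [hsum, Fin.sum_univ_castSucc, hmap, add_comm (Multiset.map _ _), Multiset.foldl_add,
    Multiset.foldl_add]
  refine (congrArg ParkingState.exited (init_foldl_castSucc t _ _)).trans ?_
  congr 2
  rcases Nat.eq_zero_or_pos (a (Fin.last (n + 1))) with h | h
  · simp [h, ParkingState.init]
  · obtain ⟨k, hk⟩ := Nat.exists_eq_succ_of_ne_zero h.ne'
    have hp : parkCar t ⟨∅, 0⟩ (Fin.last (n + 1)) = ⟨{Fin.last (n + 1)}, 0⟩ := by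
      unfold parkCar
      rw [parkingSpot]
      simp
    rw [hk, Nat.succ_eq_add_one, Multiset.replicate_succ, Multiset.foldl_cons, hp,
      init_foldl_replicate_last _ _ _ (by simp)]
    congr 1
    simp only [ParkingState.init, ParkingState.mk.injEq, and_true]
    ext u
    simp [Fin.castSucc_ne_last]

theorem flux_one (t : RecursiveTree 1) (a : Fin 1 → ℕ) : flux t a = a 0 - 1 := by
  have key : ∀ k e, ((Multiset.replicate k (0 : Fin 1)).foldl (parkCar t) ⟨{0}, e⟩) =
      ⟨{0}, e + k⟩ := by
    intro k
    induction k with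
    | zero => simp
    | succ k ih =>
      intro e
      have : parkCar t ⟨{0}, e⟩ 0 = ⟨{0}, e + 1⟩ := by
        unfold parkCar
        rw [parkingSpot]
        simp
      rw [Multiset.replicate_succ, Multiset.foldl_cons, this, ih, add_assoc, add_comm 1]
  unfold flux
  rw [Fin.sum_univ_one]
  rcases a 0 with _ | k
  · simp
  · have : parkCar t ⟨∅, 0⟩ 0 = ⟨{0}, 0⟩ := by
      unfold parkCar
      rw [parkingSpot]
      simp
    rw [Multiset.replicate_succ, Multiset.foldl_cons, this, key]
    simp

/-! ### Binary trees -/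

/-- Finite binary trees with leaves labelled by `ι`. A rooted tree is encoded by its vertices as
leaves: `join a b` stands for the tree `a` together with one more subtree `b`, attached to the root
of `a` and older than the subtrees of that root in `a`. -/
inductive BinTree (ι : Type) : Type
  | leaf (i : ι) : BinTree ι
  | join (a b : BinTree ι) : BinTree ι

namespace BinTree

variable {ι κ : Type}

/-- The number of cars that visit the root if `x i` cars arrive at the vertex `i`. -/
def eval : BinTree ι → (ι → ℕ) → ℕ
  | leaf i, x => x i
  | join a b, x => a.eval x + (b.eval x - 1)

/-- Substitution of trees for the leaves. -/
def bind : BinTree ι → (ι → BinTree κ) → BinTree κ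
  | leaf i, f => f i
  | join a b, f => join (a.bind f) (b.bind f)

/-- The labels of the leaves, with multiplicity. -/
def leaves : BinTree ι → Multiset ι
  | leaf i => {i}
  | join a b => a.leaves + b.leaves

/-- The tree without its labels. -/
def shape (t : BinTree ι) : BinTree Unit := t.bind fun _ => leaf ()

theorem eval_bind (t : BinTree ι) (f : ι → BinTree κ) (x : κ → ℕ) :
    (t.bind f).eval x = t.eval fun i => (f i).eval x := by
  induction t with
  | leaf i => rfl
  | join a b iha ihb => simp [bind, eval, iha, ihb]

theorem leaves_bind (t : BinTree ι) (f : ι → BinTree κ) :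
    (t.bind f).leaves = t.leaves.bind fun i => (f i).leaves := by
  induction t with
  | leaf i => simp [bind, leaves]
  | join a b iha ihb => simp [bind, leaves, iha, ihb]

theorem shape_bind (t : BinTree ι) (f : ι → BinTree κ) :
    (t.bind f).shape = t.bind fun i => (f i).shape := by
  induction t with
  | leaf i => rfl
  | join a b iha ihb =>
    simp only [shape] at iha ihb
    simp [shape, bind, iha, ihb]

theorem bind_congr (t : BinTree ι) {f g : ι → BinTree κ} (h : ∀ i ∈ t.leaves, f i = g i) :
    t.bind f = t.bind g := by
  induction t with
  | leaf i => exact h i (by simp [leaves])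
  | join a b iha ihb =>
    simp [bind, iha fun i hi => h i (by simp [leaves, hi]),
      ihb fun i hi => h i (by simp [leaves, hi])]

theorem eval_congr (t : BinTree ι) {x y : ι → ℕ} (h : ∀ i ∈ t.leaves, x i = y i) :
    t.eval x = t.eval y := by
  induction t with
  | leaf i => exact h i (by simp [leaves])
  | join a b iha ihb =>
    simp [eval, iha fun i hi => h i (by simp [leaves, hi]),
      ihb fun i hi => h i (by simp [leaves, hi])]

/-- The sum of `F` over the trees obtained from a tree by splitting one of its leaves in two. -/
def growSum : BinTree Unit → (BinTree Unit → ℝ) → ℝ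
  | leaf i, F => F (join (leaf i) (leaf i))
  | join a b, F => a.growSum (fun a' => F (join a' b)) + b.growSum (fun b' => F (join a b'))

/-- If the labels are distinct, the leaf to be split can be named by its label. -/
theorem sum_leaves_split [DecidableEq ι] (t : BinTree ι) (ht : t.leaves.Nodup)
    (F : BinTree Unit → ℝ) :
    (t.leaves.map fun p => F (t.bind fun i =>
      if i = p then join (leaf ()) (leaf ()) else leaf ())).sum = t.shape.growSum F := by
  induction t generalizing F with
  | leaf i => simp [leaves, bind, shape, growSum]
  | join a b iha ihb =>
    obtain ⟨ha, hb, hab⟩ := Multiset.nodup_add.mp ht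
    have h1 : ∀ p ∈ b.leaves, (a.bind fun i =>
        if i = p then join (leaf ()) (leaf ()) else leaf ()) = a.shape := fun p hp =>
      a.bind_congr fun i hi => if_neg (by
        rintro rfl; exact Multiset.disjoint_left.mp hab hi hp)
    have h2 : ∀ p ∈ a.leaves, (b.bind fun i =>
        if i = p then join (leaf ()) (leaf ()) else leaf ()) = b.shape := fun p hp =>
      b.bind_congr fun i hi => if_neg (by
        rintro rfl; exact Multiset.disjoint_left.mp hab hp hi)
    change _ = a.shape.growSum (fun a' => F (join a' b.shape)) +
      b.shape.growSum (fun b' => F (join a.shape b'))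
    rw [leaves, Multiset.map_add, Multiset.sum_add, ← iha ha, ← ihb hb]
    congr 2
    · exact Multiset.map_congr rfl fun p hp => by rw [bind, h2 p hp]
    · exact Multiset.map_congr rfl fun p hp => by rw [bind, h1 p hp]

end BinTree

/-- The encoding of a recursive tree as a binary tree. A new vertex attached to `p` splits the
leaf `p`. -/
def RecursiveTree.toBinTree : (n : ℕ) → RecursiveTree (n + 1) → BinTree (Fin (n + 1))
  | 0, _ => .leaf 0
  | n + 1, t => (toBinTree n t.init).bind fun i =>
      if i = t.lastParent then .join (.leaf i.castSucc) (.leaf (Fin.last (n + 1)))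
      else .leaf i.castSucc

theorem flux_eq_eval {n : ℕ} (t : RecursiveTree (n + 1)) (a : Fin (n + 1) → ℕ) :
    flux t a = (RecursiveTree.toBinTree n t).eval a - 1 := by
  induction n with
  | zero => exact flux_one t a
  | succ n ih =>
    rw [flux_eq_flux_init, ih, RecursiveTree.toBinTree, BinTree.eval_bind]
    congr 2
    funext i
    split_ifs <;> simp [BinTree.eval]

theorem leaves_toBinTree {n : ℕ} (t : RecursiveTree (n + 1)) :
    (RecursiveTree.toBinTree n t).leaves = Finset.univ.val := by
  induction n with
  | zero => rfl
  | succ n ih =>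
    rw [RecursiveTree.toBinTree, BinTree.leaves_bind, ih]
    have : ∀ i : Fin (n + 1), (if i = t.lastParent then
        BinTree.join (.leaf i.castSucc) (.leaf (Fin.last (n + 1)))
        else BinTree.leaf i.castSucc).leaves =
        {i.castSucc} + if i = t.lastParent then {Fin.last (n + 1)} else 0 := by
      intro i
      split_ifs <;> simp [BinTree.leaves]
    simp only [this, Multiset.bind_add, Multiset.bind_singleton]
    have h2 : (Finset.univ.val.bind fun i : Fin (n + 1) =>
        if i = t.lastParent then ({Fin.last (n + 1)} : Multiset (Fin (n + 2))) else 0) =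
        {Fin.last (n + 1)} := by
      change (∑ i : Fin (n + 1), if i = t.lastParent then
        ({Fin.last (n + 1)} : Multiset (Fin (n + 2))) else 0) = _
      simp
    rw [h2, Fin.univ_castSuccEmb (n + 1), Finset.cons_val, Finset.map_val]
    exact (add_comm _ _).trans (Multiset.singleton_add _ _)

/-- Uniform recursive trees grow by splitting uniform leaves. -/
theorem sum_shape_toBinTree_succ (n : ℕ) (F : BinTree Unit → ℝ) :
    ∑ t : RecursiveTree (n + 2), F (RecursiveTree.toBinTree (n + 1) t).shape =
      ∑ t : RecursiveTree (n + 1), (RecursiveTree.toBinTree n t).shape.growSum F := by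
  rw [← (RecursiveTree.snocEquiv n).symm.sum_comp, Fintype.sum_prod_type]
  refine Finset.sum_congr rfl fun t _ => ?_
  rw [← BinTree.sum_leaves_split _ (by rw [leaves_toBinTree]; exact Finset.univ.nodup),
    leaves_toBinTree]
  refine Finset.sum_congr rfl fun p _ => ?_
  have h := Prod.ext_iff.mp ((RecursiveTree.snocEquiv n).apply_symm_apply (t, p))
  have h1 : ((RecursiveTree.snocEquiv n).symm (t, p)).init = t := h.1
  have h2 : ((RecursiveTree.snocEquiv n).symm (t, p)).lastParent = p := h.2
  rw [RecursiveTree.toBinTree, BinTree.shape_bind, h1, h2]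
  congr 2
  funext i
  split_ifs <;> rfl

/-! ### Expectations over random binary trees -/

namespace BinTree

/-- The number of leaves. -/
def size : BinTree Unit → ℕ
  | leaf _ => 1
  | join a b => a.size + b.size

/-- The expectation of `f X`, where `X` is the number of cars that visit the root if two cars arrive
at every leaf with probability `p`, and none otherwise, independently of each other. -/
def arrivalMean (p : ℝ) : BinTree Unit → (ℕ → ℝ) → ℝ
  | leaf _, f => (1 - p) * f 0 + p * f 2
  | join a b, f => a.arrivalMean p fun x => b.arrivalMean p fun y => f (x + (y - 1))

theorem growSum_add (t : BinTree Unit) (F G : BinTree Unit → ℝ) :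
    t.growSum (fun s => F s + G s) = t.growSum F + t.growSum G := by
  induction t generalizing F G with
  | leaf i => rfl
  | join a b iha ihb => simp only [growSum, iha, ihb]; ring

theorem growSum_const_mul (t : BinTree Unit) (c : ℝ) (F : BinTree Unit → ℝ) :
    t.growSum (fun s => c * F s) = c * t.growSum F := by
  induction t generalizing F with
  | leaf i => rfl
  | join a b iha ihb => simp only [growSum, iha, ihb]; ring

theorem growSum_mono (t : BinTree Unit) {F G : BinTree Unit → ℝ} (h : ∀ s, F s ≤ G s) :
    t.growSum F ≤ t.growSum G := by
  induction t generalizing F G with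
  | leaf i => exact h _
  | join a b iha ihb => exact add_le_add (iha fun s => h _) (ihb fun s => h _)

theorem growSum_size_mul (t : BinTree Unit) (F : BinTree Unit → ℝ) (k : ℝ) :
    t.growSum (fun s => (s.size + k) * F s) = (t.size + 1 + k) * t.growSum F := by
  induction t generalizing F k with
  | leaf i => norm_num [growSum, size]
  | join a b iha ihb =>
    have ha := iha (fun s => F (join s b)) (b.size + k)
    have hb := ihb (fun s => F (join a s)) (a.size + k)
    simp only [growSum, size, Nat.cast_add]
    calc _ = a.growSum (fun s => (s.size + (b.size + k)) * F (join s b)) +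
          b.growSum (fun s => (s.size + (a.size + k)) * F (join a s)) := by
          congr 2 <;> funext s <;> ring
      _ = _ := by rw [ha, hb]; ring

theorem arrivalMean_add (p : ℝ) (t : BinTree Unit) (f g : ℕ → ℝ) :
    t.arrivalMean p (fun x => f x + g x) = t.arrivalMean p f + t.arrivalMean p g := by
  induction t generalizing f g with
  | leaf i => simp only [arrivalMean]; ring
  | join a b iha ihb => simp only [arrivalMean, iha, ihb]

theorem arrivalMean_const_mul (p : ℝ) (t : BinTree Unit) (c : ℝ) (f : ℕ → ℝ) :
    t.arrivalMean p (fun x => c * f x) = c * t.arrivalMean p f := by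
  induction t generalizing f with
  | leaf i => simp only [arrivalMean]; ring
  | join a b iha ihb => simp only [arrivalMean, iha, ihb]

theorem arrivalMean_const (p : ℝ) (t : BinTree Unit) (c : ℝ) :
    t.arrivalMean p (fun _ => c) = c := by
  induction t with
  | leaf i => simp only [arrivalMean]; ring
  | join a b iha ihb => simp only [arrivalMean, iha, ihb]

theorem arrivalMean_mono {p : ℝ} (hp0 : 0 ≤ p) (hp1 : p ≤ 1) (t : BinTree Unit) {f g : ℕ → ℝ}
    (h : ∀ x, f x ≤ g x) : t.arrivalMean p f ≤ t.arrivalMean p g := by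
  induction t generalizing f g with
  | leaf i =>
    exact add_le_add (mul_le_mul_of_nonneg_left (h _) (sub_nonneg.mpr hp1))
      (mul_le_mul_of_nonneg_left (h _) hp0)
  | join a b iha ihb => exact iha fun x => ihb fun y => h _

theorem arrivalMean_nonneg {p : ℝ} (hp0 : 0 ≤ p) (hp1 : p ≤ 1) (t : BinTree Unit) {f : ℕ → ℝ}
    (h : ∀ x, 0 ≤ f x) : 0 ≤ t.arrivalMean p f :=
  (arrivalMean_const p t 0).symm.trans_le (arrivalMean_mono hp0 hp1 t h)

/-- Splitting a leaf adds a vertex, which can only increase the number of cars at the root. -/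
theorem growSum_arrivalMean_le {p : ℝ} (hp0 : 0 ≤ p) (hp1 : p ≤ 1) (t : BinTree Unit)
    {f : ℕ → ℝ} (hf : Antitone f) :
    t.growSum (fun s => s.arrivalMean p f) ≤ t.size * t.arrivalMean p f := by
  induction t generalizing f with
  | leaf i =>
    simp only [growSum, size, Nat.cast_one, one_mul]
    change (leaf i).arrivalMean p (fun x => (leaf i).arrivalMean p fun y => f (x + (y - 1))) ≤ _
    refine arrivalMean_mono hp0 hp1 _ fun x => ?_
    calc _ ≤ (leaf i).arrivalMean p fun _ => f x :=
          arrivalMean_mono hp0 hp1 _ fun y => hf (Nat.le_add_right _ _)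
      _ = f x := arrivalMean_const _ _ _
  | join a b iha ihb =>
    simp only [growSum, size, Nat.cast_add, arrivalMean, add_mul]
    refine add_le_add (iha fun x y h => arrivalMean_mono hp0 hp1 _ fun z =>
      hf (Nat.add_le_add_right h _)) ?_
    have comm : ∀ (t : BinTree Unit) (G : BinTree Unit → ℕ → ℝ),
        t.growSum (fun s => a.arrivalMean p (G s)) =
          a.arrivalMean p fun x => t.growSum fun s => G s x := by
      intro t
      induction t with
      | leaf i => intro G; rfl
      | join c d ihc ihd => intro G; simp only [growSum, ihc, ihd, arrivalMean_add]
    rw [comm, ← arrivalMean_const_mul]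
    exact arrivalMean_mono hp0 hp1 _ fun x => ihb fun y z h =>
      hf (Nat.add_le_add_left (Nat.sub_le_sub_right h 1) x)

end BinTree

/-- The mean of `F` over the random binary tree with `n + 1` leaves that grows by splitting uniform
leaves. -/
noncomputable def treeMean : ℕ → (BinTree Unit → ℝ) → ℝ
  | 0, F => F (.leaf ())
  | n + 1, F => treeMean n (fun t => t.growSum F) / (n + 1)

theorem sum_shape_toBinTree (n : ℕ) (F : BinTree Unit → ℝ) :
    ∑ t : RecursiveTree (n + 1), F (RecursiveTree.toBinTree n t).shape =
      n.factorial * treeMean n F := by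
  induction n generalizing F with
  | zero =>
    have : Unique (RecursiveTree (0 + 1)) :=
      ⟨⟨fun v => absurd (Nat.lt_one_iff.mp v.1.isLt) v.2⟩, fun t => by
        funext v; exact absurd (Nat.lt_one_iff.mp v.1.isLt) v.2⟩
    rw [Fintype.sum_unique]
    simp [RecursiveTree.toBinTree, treeMean, BinTree.shape, BinTree.bind]
  | succ n ih =>
    rw [sum_shape_toBinTree_succ, ih fun t => t.growSum F, treeMean, Nat.factorial_succ]
    push_cast
    field_simp

theorem treeMean_add (n : ℕ) (F G : BinTree Unit → ℝ) :
    treeMean n (fun t => F t + G t) = treeMean n F + treeMean n G := by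
  induction n generalizing F G with
  | zero => rfl
  | succ n ih => simp only [treeMean, BinTree.growSum_add, ih, add_div]

theorem treeMean_const_mul (n : ℕ) (c : ℝ) (F : BinTree Unit → ℝ) :
    treeMean n (fun t => c * F t) = c * treeMean n F := by
  induction n generalizing F with
  | zero => rfl
  | succ n ih => simp only [treeMean, BinTree.growSum_const_mul, ih, mul_div_assoc]

theorem treeMean_mono (n : ℕ) {F G : BinTree Unit → ℝ} (h : ∀ t, F t ≤ G t) :
    treeMean n F ≤ treeMean n G := by
  induction n generalizing F G with
  | zero => exact h _
  | succ n ih =>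
    exact div_le_div_of_nonneg_right (ih fun t => t.growSum_mono h) (by positivity)

theorem treeMean_size_mul (n : ℕ) (F : BinTree Unit → ℝ) (k : ℝ) :
    treeMean n (fun t => (t.size + k) * F t) = (n + 1 + k) * treeMean n F := by
  induction n generalizing F k with
  | zero => simp [treeMean, BinTree.size]
  | succ n ih =>
    simp only [treeMean, BinTree.growSum_size_mul, add_assoc, ih]
    push_cast
    ring

theorem growSum_treeMean_comm (n : ℕ) (a : BinTree Unit)
    (F : BinTree Unit → BinTree Unit → ℝ) :
    a.growSum (fun s => treeMean n (F s)) = treeMean n fun b => a.growSum fun s => F s b := by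
  induction a generalizing F with
  | leaf i => rfl
  | join c d ihc ihd => simp only [BinTree.growSum, ihc, ihd, treeMean_add]

theorem arrivalMean_treeMean_comm (p : ℝ) (n : ℕ) (a : BinTree Unit)
    (F : ℕ → BinTree Unit → ℝ) :
    a.arrivalMean p (fun x => treeMean n (F x)) =
      treeMean n fun b => a.arrivalMean p fun x => F x b := by
  induction a generalizing F with
  | leaf i => simp only [BinTree.arrivalMean, treeMean_add, treeMean_const_mul]
  | join c d ihc ihd => simp only [BinTree.arrivalMean, ihc, ihd]

/-- The two subtrees of the random binary tree are, given their sizes, independent random binary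
trees, and the number of leaves of the first one is uniform. -/
theorem treeMean_succ_eq_sum (n : ℕ) (F : BinTree Unit → ℝ) :
    (n + 1) * treeMean (n + 1) F = ∑ ij ∈ Finset.HasAntidiagonal.antidiagonal n,
      treeMean ij.1 fun a => treeMean ij.2 fun b => F (.join a b) := by
  induction n generalizing F with
  | zero => simp [treeMean, BinTree.growSum]
  | succ n ih =>
    set K : ℕ → ℕ → ℝ := fun i j => treeMean i fun a => treeMean j fun b => F (.join a b) with hK
    have hsucc : ∀ m (G : BinTree Unit → ℝ),
        treeMean m (fun t => t.growSum G) = (m + 1) * treeMean (m + 1) G := by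
      intro m G
      rw [treeMean]
      field_simp
    have h1 : ∀ i j, treeMean i (fun a => treeMean j fun b =>
        a.growSum fun s => F (.join s b)) = (i + 1) * K (i + 1) j := by
      intro i j
      simp only [← growSum_treeMean_comm, hsucc, hK]
    have h2 : ∀ i j, treeMean i (fun a => treeMean j fun b =>
        b.growSum fun s => F (.join a s)) = (j + 1) * K i (j + 1) := by
      intro i j
      simp only [hsucc, treeMean_const_mul, hK]
    have h3 := ih (fun t => t.growSum F)
    simp only [BinTree.growSum, treeMean_add, h1, h2] at h3
    rw [Finset.sum_add_distrib] at h3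
    have h4 := Finset.Nat.sum_antidiagonal_succ (n := n) (f := fun ij => (ij.1 : ℝ) * K ij.1 ij.2)
    have h5 := Finset.Nat.sum_antidiagonal_succ' (n := n) (f := fun ij => (ij.2 : ℝ) * K ij.1 ij.2)
    simp only [Nat.cast_zero, zero_mul, zero_add, Nat.cast_add, Nat.cast_one] at h4 h5
    rw [← h4, ← h5, ← Finset.sum_add_distrib] at h3
    have h6 : ∑ ij ∈ Finset.HasAntidiagonal.antidiagonal (n + 1),
        ((ij.1 : ℝ) * K ij.1 ij.2 + ij.2 * K ij.1 ij.2) =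
        (n + 1) * ∑ ij ∈ Finset.HasAntidiagonal.antidiagonal (n + 1), K ij.1 ij.2 := by
      rw [Finset.mul_sum]
      refine Finset.sum_congr rfl fun ij hij => ?_
      rw [← add_mul, ← Nat.cast_add, Finset.HasAntidiagonal.mem_antidiagonal.mp hij]
      push_cast
      ring
    rw [h6, hsucc] at h3
    have h7 : (n : ℝ) + 1 ≠ 0 := by positivity
    exact mul_left_cancel₀ h7 h3

theorem treeMean_const (n : ℕ) (c : ℝ) : treeMean n (fun _ => c) = c := by
  cases n with
  | zero => rfl
  | succ n =>
    induction n using Nat.strong_induction_on with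
    | _ n ih =>
      have h0 : ∀ m ≤ n, treeMean m (fun _ => c) = c := by
        intro m hm
        cases m with
        | zero => rfl
        | succ m => exact ih m hm
      have h := treeMean_succ_eq_sum n fun _ => c
      rw [Finset.sum_congr rfl fun ij hij => by
        have hij' := Finset.HasAntidiagonal.mem_antidiagonal.mp hij
        rw [h0 ij.2 (by omega), h0 ij.1 (by omega)],
        Finset.sum_const, Finset.Nat.card_antidiagonal, nsmul_eq_mul] at h
      push_cast at h
      exact mul_left_cancel₀ (by positivity) h

/-- The expectation of `f X`, where `X` is the number of cars that visit the root of a uniform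
recursive tree with `n + 1` vertices, if two cars arrive at every vertex with probability `p`, and
none otherwise. -/
noncomputable def visitMean (p : ℝ) (n : ℕ) (f : ℕ → ℝ) : ℝ :=
  treeMean n fun t => t.arrivalMean p f

/-- The subtree of the second vertex has a uniform size, and it adds its flux to the cars that
visit the root in the remaining tree. -/
theorem visitMean_succ_eq_sum (p : ℝ) (n : ℕ) (f : ℕ → ℝ) :
    (n + 1) * visitMean p (n + 1) f = ∑ ij ∈ Finset.HasAntidiagonal.antidiagonal n,
      visitMean p ij.1 fun x => visitMean p ij.2 fun y => f (x + (y - 1)) := by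
  unfold visitMean
  rw [treeMean_succ_eq_sum]
  simp only [arrivalMean_treeMean_comm, BinTree.arrivalMean]

theorem visitMean_zero (p : ℝ) (f : ℕ → ℝ) : visitMean p 0 f = (1 - p) * f 0 + p * f 2 := rfl

theorem visitMean_add (p : ℝ) (n : ℕ) (f g : ℕ → ℝ) :
    visitMean p n (fun x => f x + g x) = visitMean p n f + visitMean p n g := by
  simp only [visitMean, BinTree.arrivalMean_add, treeMean_add]

theorem visitMean_const_mul (p : ℝ) (n : ℕ) (c : ℝ) (f : ℕ → ℝ) :
    visitMean p n (fun x => c * f x) = c * visitMean p n f := by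
  simp only [visitMean, BinTree.arrivalMean_const_mul, treeMean_const_mul]

theorem visitMean_sub (p : ℝ) (n : ℕ) (f g : ℕ → ℝ) :
    visitMean p n (fun x => f x - g x) = visitMean p n f - visitMean p n g := by
  have h := visitMean_add p n f fun x => -1 * g x
  rw [visitMean_const_mul] at h
  simpa [sub_eq_add_neg] using h

theorem visitMean_const (p : ℝ) (n : ℕ) (c : ℝ) : visitMean p n (fun _ => c) = c := by
  simp only [visitMean, BinTree.arrivalMean_const, treeMean_const]

theorem visitMean_mono {p : ℝ} (hp0 : 0 ≤ p) (hp1 : p ≤ 1) (n : ℕ) {f g : ℕ → ℝ}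
    (h : ∀ x, f x ≤ g x) : visitMean p n f ≤ visitMean p n g :=
  treeMean_mono n fun t => t.arrivalMean_mono hp0 hp1 h

theorem visitMean_nonneg {p : ℝ} (hp0 : 0 ≤ p) (hp1 : p ≤ 1) (n : ℕ) {f : ℕ → ℝ}
    (h : ∀ x, 0 ≤ f x) : 0 ≤ visitMean p n f :=
  (visitMean_const p n 0).symm.trans_le (visitMean_mono hp0 hp1 n h)

/-- The number of cars that visit the root is stochastically increasing in the size of the tree. -/
theorem antitone_visitMean {p : ℝ} (hp0 : 0 ≤ p) (hp1 : p ≤ 1) {f : ℕ → ℝ} (hf : Antitone f) :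
    Antitone fun n => visitMean p n f := by
  refine antitone_nat_of_succ_le fun n => ?_
  change treeMean n _ / _ ≤ _
  rw [div_le_iff₀ (by positivity)]
  have h := treeMean_size_mul n (fun t => t.arrivalMean p f) 0
  simp only [add_zero] at h
  calc _ ≤ treeMean n fun t => t.size * t.arrivalMean p f :=
        treeMean_mono n fun t => t.growSum_arrivalMean_le hp0 hp1 hf
    _ = _ := by rw [h, mul_comm]; rfl

/-! ### The law of the flux -/

theorem isProbabilityMeasure_binaryLaw {α : ℝ} (h0 : 0 ≤ α) (h1 : α ≤ 1) :
    IsProbabilityMeasure (binaryLaw α) := by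
  constructor
  simp only [binaryLaw, Measure.coe_add, Measure.coe_smul, Pi.add_apply, Pi.smul_apply,
    measure_univ, smul_eq_mul, mul_one]
  rw [← ENNReal.ofReal_add (by linarith) (by linarith)]
  simp

/-- The leaves of disjoint subtrees receive independent arrivals. -/
theorem lintegral_eval {ι : Type} [Fintype ι] [DecidableEq ι] {α : ℝ} (h0 : 0 ≤ α) (h1 : α ≤ 1)
    (t : BinTree ι) (ht : t.leaves.Nodup) {f : ℕ → ℝ} (hf : ∀ x, 0 ≤ f x) :
    ∫⁻ x, ENNReal.ofReal (f (t.eval x)) ∂(Measure.pi fun _ : ι => binaryLaw α) =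
      ENNReal.ofReal (t.shape.arrivalMean (α / 2) f) := by
  have := isProbabilityMeasure_binaryLaw h0 h1
  have hp0 : 0 ≤ α / 2 := by linarith
  have hp1 : α / 2 ≤ 1 := by linarith
  induction t generalizing f with
  | leaf i =>
    have hmp := measurePreserving_eval (fun _ : ι => binaryLaw α) i
    have := hmp.lintegral_comp (f := fun k : ℕ => ENNReal.ofReal (f k)) Measurable.of_discrete
    simp only [Function.eval] at this
    simp only [BinTree.eval, BinTree.shape, BinTree.bind, BinTree.arrivalMean]
    rw [this, binaryLaw, lintegral_add_measure, lintegral_smul_measure, lintegral_smul_measure,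
      lintegral_dirac, lintegral_dirac, ENNReal.ofReal_add, ENNReal.ofReal_mul,
      ENNReal.ofReal_mul]
    · rfl
    · exact hp0
    · linarith
    · exact mul_nonneg (by linarith) (hf 0)
    · exact mul_nonneg hp0 (hf 2)
  | join a b iha ihb =>
    obtain ⟨ha, hb, hab⟩ := Multiset.nodup_add.mp ht
    have hind : iIndepFun (fun i (x : ι → ℕ) => x i) (Measure.pi fun _ : ι => binaryLaw α) :=
      iIndepFun_pi (X := fun _ => id) fun _ => aemeasurable_id
    have hdisj : Disjoint a.leaves.toFinset b.leaves.toFinset := by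
      rw [Finset.disjoint_left]
      intro i hi hi'
      exact Multiset.disjoint_left.mp hab (Multiset.mem_toFinset.mp hi)
        (Multiset.mem_toFinset.mp hi')
    have hI := hind.indepFun_finset _ _ hdisj fun i => measurable_pi_apply i
    have hfac : ∀ c : BinTree ι, c.eval =
        (fun y : c.leaves.toFinset → ℕ =>
          c.eval fun i => if h : i ∈ c.leaves.toFinset then y ⟨i, h⟩ else 0) ∘
        fun (x : ι → ℕ) (i : c.leaves.toFinset) => x i := by
      intro c
      funext x
      refine c.eval_congr fun i hi => ?_
      simp [hi]
    have hI2 : IndepFun a.eval b.eval (Measure.pi fun _ : ι => binaryLaw α) := by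
      rw [hfac a, hfac b]
      exact hI.comp Measurable.of_discrete Measurable.of_discrete
    have ma : Measurable (a.eval : (ι → ℕ) → ℕ) := Measurable.of_discrete
    have mb : Measurable (b.eval : (ι → ℕ) → ℕ) := Measurable.of_discrete
    rw [indepFun_iff_map_prod_eq_prod_map_map ma.aemeasurable mb.aemeasurable] at hI2
    calc ∫⁻ x, ENNReal.ofReal (f ((a.join b).eval x)) ∂(Measure.pi fun _ : ι => binaryLaw α)
        = ∫⁻ q : ℕ × ℕ, ENNReal.ofReal (f (q.1 + (q.2 - 1)))
            ∂((Measure.pi fun _ : ι => binaryLaw α).map fun x => (a.eval x, b.eval x)) := by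
          rw [lintegral_map Measurable.of_discrete (ma.prodMk mb)]
          rfl
      _ = ∫⁻ x, ∫⁻ y, ENNReal.ofReal (f (a.eval x + (b.eval y - 1)))
            ∂(Measure.pi fun _ : ι => binaryLaw α) ∂(Measure.pi fun _ : ι => binaryLaw α) := by
          have := Measure.isProbabilityMeasure_map (μ := Measure.pi fun _ : ι => binaryLaw α)
            mb.aemeasurable
          rw [hI2, lintegral_prod _ Measurable.of_discrete.aemeasurable,
            lintegral_map Measurable.of_discrete ma]
          refine lintegral_congr fun x => ?_
          rw [lintegral_map Measurable.of_discrete mb]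
      _ = ∫⁻ x, ENNReal.ofReal (b.shape.arrivalMean (α / 2) fun y => f (a.eval x + (y - 1)))
            ∂(Measure.pi fun _ : ι => binaryLaw α) := by
          refine lintegral_congr fun x => ?_
          exact ihb hb (f := fun y => f (a.eval x + (y - 1))) fun y => hf _
      _ = _ := iha ha (f := fun x => b.shape.arrivalMean (α / 2) fun y => f (x + (y - 1)))
          fun x => b.shape.arrivalMean_nonneg hp0 hp1 fun y => hf _

theorem lintegral_flux {α : ℝ} (h0 : 0 ≤ α) (h1 : α ≤ 1) (n : ℕ) {f : ℕ → ℝ}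
    (hf : ∀ x, 0 ≤ f x) :
    ∫⁻ q, ENNReal.ofReal (f (flux q.1 q.2)) ∂(parkingLaw (n + 1) (binaryLaw α)) =
      ENNReal.ofReal (visitMean (α / 2) n fun x => f (x - 1)) := by
  have := isProbabilityMeasure_binaryLaw h0 h1
  have hp0 : 0 ≤ α / 2 := by linarith
  have hp1 : α / 2 ≤ 1 := by linarith
  have hcard : (Fintype.card (RecursiveTree (n + 1)) : ℝ) = n.factorial := by
    have h := sum_shape_toBinTree n fun _ => 1
    rw [treeMean_const] at h
    simpa using h
  have hcard' : Fintype.card (RecursiveTree (n + 1)) = n.factorial := by exact_mod_cast hcard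
  have hpos : (0 : ℝ) < n.factorial := by exact_mod_cast n.factorial_pos
  have : Nonempty (RecursiveTree (n + 1)) :=
    Fintype.card_pos_iff.mp (hcard' ▸ n.factorial_pos)
  have hm : ∀ t : RecursiveTree (n + 1),
      uniformOn (Set.univ : Set (RecursiveTree (n + 1))) {t} = ENNReal.ofReal (n.factorial : ℝ)⁻¹ := by
    intro t
    rw [uniformOn_univ, Measure.count_singleton, hcard', ENNReal.ofReal_inv_of_pos hpos,
      ENNReal.ofReal_natCast, one_div]
  rw [parkingLaw, lintegral_prod _ Measurable.of_discrete.aemeasurable, lintegral_fintype]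
  calc _ = ∑ t : RecursiveTree (n + 1), ENNReal.ofReal
        ((RecursiveTree.toBinTree n t).shape.arrivalMean (α / 2) (fun x => f (x - 1)) *
          (n.factorial : ℝ)⁻¹) := by
        refine Finset.sum_congr rfl fun t _ => ?_
        rw [hm, ENNReal.ofReal_mul (BinTree.arrivalMean_nonneg hp0 hp1 _ fun x => hf _)]
        simp only [flux_eq_eval]
        rw [← lintegral_eval h0 h1 (RecursiveTree.toBinTree n t)
          (by rw [leaves_toBinTree]; exact Finset.univ.nodup) (f := fun x => f (x - 1))
          fun x => hf _]
    _ = _ := by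
        rw [← ENNReal.ofReal_sum_of_nonneg fun t _ => mul_nonneg
          (BinTree.arrivalMean_nonneg hp0 hp1 _ fun x => hf _) (by positivity),
          ← Finset.sum_mul, sum_shape_toBinTree n fun t => t.arrivalMean (α / 2) fun x => f (x - 1)]
        congr 1
        rw [visitMean]
        field_simp

theorem parkingLaw_flux_mem {α : ℝ} (h0 : 0 ≤ α) (h1 : α ≤ 1) (n : ℕ) (B : Set ℕ) :
    parkingLaw (n + 1) (binaryLaw α) {q | flux q.1 q.2 ∈ B} =
      ENNReal.ofReal (visitMean (α / 2) n fun x => B.indicator 1 (x - 1)) := by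
  rw [← lintegral_flux h0 h1 n (f := B.indicator 1)
    fun x => Set.indicator_nonneg (fun _ _ => zero_le_one) x,
    ← lintegral_indicator_one (MeasurableSet.of_discrete)]
  refine lintegral_congr fun q => ?_
  by_cases h : flux q.1 q.2 ∈ B <;> simp [h]

/-! ### The subcritical regime -/

/-- The growth factor of the exponential moment in a tree with `n + 1` vertices: the solution of
`(n + 1) Q (n + 1) = (1 + b) ∑ k ≤ n, Q k` with `Q 0 = 1`. -/
noncomputable def growthFactor (b : ℝ) (n : ℕ) : ℝ := ∏ k ∈ Finset.range n, (1 + b / (k + 1))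

theorem growthFactor_pos {b : ℝ} (hb : 0 ≤ b) (n : ℕ) : 0 < growthFactor b n :=
  Finset.prod_pos fun k _ => by positivity

theorem growthFactor_mono {b : ℝ} (hb : 0 ≤ b) : Monotone (growthFactor b) := by
  refine monotone_nat_of_le_succ fun n => ?_
  rw [growthFactor, growthFactor, Finset.prod_range_succ]
  refine le_mul_of_one_le_right (growthFactor_pos hb n).le ?_
  have : 0 ≤ b / ((n : ℝ) + 1) := by positivity
  linarith

theorem growthFactor_succ (b : ℝ) (n : ℕ) :
    (1 + b) * ∑ k ∈ Finset.range (n + 1), growthFactor b k = (n + 1) * growthFactor b (n + 1) := by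
  induction n with
  | zero => simp [growthFactor]
  | succ n ih =>
    rw [Finset.sum_range_succ, mul_add, ih, growthFactor, growthFactor,
      Finset.prod_range_succ _ (n + 1)]
    push_cast
    field_simp
    ring

theorem growthFactor_le_exp {b : ℝ} (hb : 0 ≤ b) (n : ℕ) :
    growthFactor b n ≤ Real.exp (b * (1 + Real.log n)) := by
  calc growthFactor b n ≤ ∏ k ∈ Finset.range n, Real.exp (b / (k + 1)) :=
        Finset.prod_le_prod (fun k _ => by positivity) fun k _ => by
          rw [add_comm]; exact Real.add_one_le_exp _
    _ = Real.exp (b * harmonic n) := by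
        rw [← Real.exp_sum, harmonic, Rat.cast_sum, Finset.mul_sum]
        simp [div_eq_mul_inv]
    _ ≤ _ := Real.exp_le_exp.mpr (mul_le_mul_of_nonneg_left (harmonic_le_one_add_log n) hb)

/-- The exponential moment of order `log z` stays close to `1` in trees with at most `N + 1`
vertices, if `p z ^ 2` is small compared with the growth factor. -/
theorem visitMean_pow_sub_one_le {p z : ℝ} (hp0 : 0 ≤ p) (hp1 : p ≤ 1) (hz : 1 ≤ z) {N : ℕ}
    (hN : p * z ^ 2 * growthFactor (2 / z) N ≤ 1) (n : ℕ) (hn : n ≤ N) :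
    visitMean p n (fun x => z ^ x) - 1 ≤ p * z ^ 2 * growthFactor (2 / z) n := by
  have hz0 : 0 < z := by linarith
  have hb : 0 ≤ 2 / z := by positivity
  have hε : 0 ≤ p * z ^ 2 := by positivity
  set e : ℕ → ℝ := fun n => visitMean p n (fun x => z ^ x) - 1 with he
  have he0 : ∀ n, 0 ≤ e n := by
    intro n
    have h := visitMean_mono hp0 hp1 n (f := fun _ => 1) fun x => one_le_pow₀ (n := x) hz
    rw [visitMean_const] at h
    exact sub_nonneg.mpr h
  change e n ≤ _
  induction n using Nat.strong_induction_on with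
  | _ n ih =>
    cases n with
    | zero =>
      simp only [he, visitMean_zero, growthFactor, Finset.range_zero, Finset.prod_empty, pow_zero]
      nlinarith
    | succ n =>
      have he1 : ∀ k ≤ n, e k ≤ 1 := fun k hk => (ih k (by omega) (by omega)).trans <|
        (mul_le_mul_of_nonneg_left (growthFactor_mono hb (by omega : k ≤ N)) hε).trans hN
      -- the car that parks at the root of the second tree costs a factor `z`
      have hflux : ∀ j, visitMean p j (fun y => z ^ (y - 1)) ≤ 1 + e j / z := by
        intro j
        calc visitMean p j (fun y => z ^ (y - 1))
            ≤ visitMean p j (fun y => (1 - 1 / z) + 1 / z * z ^ y) := by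
              refine visitMean_mono hp0 hp1 j fun y => ?_
              cases y with
              | zero => simp
              | succ y =>
                have h1 : 1 / z ≤ 1 := by rw [div_le_one hz0]; exact hz
                have h2 : 1 / z * z ^ (y + 1) = z ^ y := by field_simp; ring
                rw [h2, Nat.add_sub_cancel]
                linarith
          _ = 1 + e j / z := by
              rw [visitMean_add, visitMean_const_mul, visitMean_const, he]
              ring
      have hsplit := visitMean_succ_eq_sum p n fun x => z ^ x
      have hterm : ∀ i j, (visitMean p i fun x => visitMean p j fun y => z ^ (x + (y - 1))) =
          visitMean p j (fun y => z ^ (y - 1)) * (1 + e i) := by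
        intro i j
        simp only [pow_add, visitMean_const_mul]
        rw [show 1 + e i = visitMean p i fun x => z ^ x from add_sub_cancel _ _,
          ← visitMean_const_mul]
        simp only [mul_comm]
      have hle : ∀ k ∈ Finset.range n.succ, (visitMean p k fun x => visitMean p (n - k) fun y =>
          z ^ (x + (y - 1))) ≤ 1 + e k + 2 / z * e (n - k) := by
        intro k hk
        have hk' : k ≤ n := Nat.lt_succ_iff.mp (Finset.mem_range.mp hk)
        rw [hterm]
        calc _ ≤ (1 + e (n - k) / z) * (1 + e k) :=
              mul_le_mul_of_nonneg_right (hflux _) (by linarith [he0 k])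
          _ = 1 + e k + e (n - k) / z * (1 + e k) := by ring
          _ ≤ 1 + e k + e (n - k) / z * 2 := by
              have := he1 k hk'
              have h3 : 0 ≤ e (n - k) / z := div_nonneg (he0 _) hz0.le
              nlinarith
          _ = _ := by ring
      rw [Finset.Nat.sum_antidiagonal_eq_sum_range_succ (fun i j => visitMean p i fun x =>
        visitMean p j fun y => z ^ (x + (y - 1)))] at hsplit
      have hsum := hsplit.trans_le (Finset.sum_le_sum hle)
      have hrefl : ∑ k ∈ Finset.range n.succ, e (n - k) = ∑ k ∈ Finset.range n.succ, e k := by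
        have := Finset.sum_range_reflect e n.succ
        simpa using this
      rw [Finset.sum_add_distrib, Finset.sum_add_distrib, ← Finset.mul_sum, hrefl,
        Finset.sum_const, Finset.card_range, nsmul_eq_mul, mul_one] at hsum
      have hQ : ∑ k ∈ Finset.range n.succ, e k ≤
          p * z ^ 2 * ∑ k ∈ Finset.range (n + 1), growthFactor (2 / z) k := by
        rw [Finset.mul_sum]
        exact Finset.sum_le_sum fun k hk =>
          ih k (Finset.mem_range.mp hk) (by have := Finset.mem_range.mp hk; omega)
      have hQ2 := mul_le_mul_of_nonneg_left hQ (by linarith : 0 ≤ 1 + 2 / z)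
      have hn1 : (0 : ℝ) < n + 1 := by positivity
      refine le_of_mul_le_mul_left ?_ hn1
      calc ((n : ℝ) + 1) * e (n + 1) ≤ (1 + 2 / z) * ∑ k ∈ Finset.range n.succ, e k := by
            simp only [he, Nat.succ_eq_add_one] at hsum ⊢
            push_cast at hsum
            linarith
        _ ≤ p * z ^ 2 * ((1 + 2 / z) * ∑ k ∈ Finset.range (n + 1), growthFactor (2 / z) k) := by
            linarith
        _ = _ := by rw [growthFactor_succ]; ring

/-- If `p log(n + 1) ^ 2` is small, then it is unlikely that two cars visit the root. -/
theorem visitMean_two_le_upper {p : ℝ} (hp0 : 0 ≤ p) (hp1 : p ≤ 1) {n : ℕ}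
    (hlog : 2 ≤ Real.log (n + 1)) (h : p * Real.log (n + 1) ^ 2 * Real.exp 3 ≤ 1) :
    visitMean p n (fun x => if 2 ≤ x then 1 else 0) ≤
      p * Real.log (n + 1) ^ 2 * Real.exp 3 := by
  set z := Real.log (n + 1) with hz
  have hz0 : 0 < z := by linarith
  have hQ : growthFactor (2 / z) n ≤ Real.exp 3 := by
    refine (growthFactor_le_exp (by positivity) n).trans (Real.exp_le_exp.mpr ?_)
    have hle : Real.log n ≤ z := by
      rcases Nat.eq_zero_or_pos n with h0 | h0
      · simp [h0, hz0.le]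
      · exact Real.log_le_log (by exact_mod_cast h0) (by linarith)
    calc 2 / z * (1 + Real.log n) ≤ 2 / z * (1 + z) :=
          mul_le_mul_of_nonneg_left (by linarith) (by positivity)
      _ = 2 / z + 2 := by field_simp
      _ ≤ 3 := by
          have : 2 / z ≤ 1 := by rw [div_le_one hz0]; exact hlog
          linarith
  have hε : 0 ≤ p * z ^ 2 := by positivity
  have hle : p * z ^ 2 * growthFactor (2 / z) n ≤ p * z ^ 2 * Real.exp 3 :=
    mul_le_mul_of_nonneg_left hQ hε
  refine le_trans ?_ ((visitMean_pow_sub_one_le hp0 hp1 (by linarith) (hle.trans h) n le_rfl).trans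
    hle)
  calc visitMean p n (fun x => if 2 ≤ x then 1 else 0)
      ≤ visitMean p n (fun x => z ^ x - 1) := by
        refine visitMean_mono hp0 hp1 n fun x => ?_
        have h1 : (1 : ℝ) ≤ z ^ x := one_le_pow₀ (by linarith)
        split_ifs with hx
        · have : z ^ 2 ≤ z ^ x := pow_le_pow_right₀ (by linarith) hx
          nlinarith
        · linarith
    _ = _ := by rw [visitMean_sub, visitMean_const]

/-! ### The supercritical regime -/

/-- The probability that at least `k` cars visit the root of a uniform recursive tree with `n + 1`
vertices. -/
noncomputable def visitTail (p : ℝ) (n k : ℕ) : ℝ :=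
  visitMean p n fun x => if k ≤ x then 1 else 0

theorem antitone_ite_lt (k : ℕ) : Antitone fun x : ℕ => if x < k then (1 : ℝ) else 0 := by
  intro x y h
  dsimp only
  split_ifs <;> first | omega | norm_num

theorem visitMean_ite_lt (p : ℝ) (n k : ℕ) :
    visitMean p n (fun x => if x < k then 1 else 0) = 1 - visitTail p n k := by
  rw [visitTail, ← visitMean_const p n 1, ← visitMean_sub]
  congr 1
  funext x
  rw [visitMean_const]
  split_ifs <;> first | omega | norm_num

section

variable {p : ℝ} (hp0 : 0 ≤ p) (hp1 : p ≤ 1)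
include hp0 hp1

theorem visitTail_nonneg (n k : ℕ) : 0 ≤ visitTail p n k :=
  visitMean_nonneg hp0 hp1 n fun x => by positivity

theorem visitTail_mono (k : ℕ) : Monotone fun n => visitTail p n k := by
  intro m n h
  have := antitone_visitMean hp0 hp1 (antitone_ite_lt k) h
  simp only [visitMean_ite_lt] at this
  dsimp only
  linarith

theorem le_visitTail_two (n : ℕ) : p ≤ visitTail p n 2 := by
  refine le_trans ?_ (visitTail_mono hp0 hp1 2 (Nat.zero_le n))
  simp [visitTail, visitMean_zero]

/-- A subtree with more than `M` vertices that is attached to the root sends a car to the root with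
probability at least `visitTail p M 2`. -/
theorem visitMean_flux_le {f : ℕ → ℝ} (hf : Antitone f) {M j : ℕ} (hM : M ≤ j) (x : ℕ) :
    visitMean p j (fun y => f (x + (y - 1))) ≤ f x - visitTail p M 2 * (f x - f (x + 1)) := by
  have h0 : 0 ≤ f x - f (x + 1) := sub_nonneg.mpr (hf (Nat.le_succ x))
  calc visitMean p j (fun y => f (x + (y - 1)))
      ≤ visitMean p j (fun y => f x - (f x - f (x + 1)) * if 2 ≤ y then 1 else 0) := by
        refine visitMean_mono hp0 hp1 j fun y => ?_
        split_ifs with hy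
        · have := hf (by omega : x + 1 ≤ x + (y - 1))
          linarith
        · have := hf (by omega : x ≤ x + (y - 1))
          linarith
    _ = f x - (f x - f (x + 1)) * visitTail p j 2 := by
        rw [visitMean_sub, visitMean_const, visitMean_const_mul, visitTail]
    _ ≤ _ := by
        have := mul_le_mul_of_nonneg_left (visitTail_mono hp0 hp1 2 hM) h0
        dsimp only at this
        linarith

/-- The drift inequality: the mean of `f` is at most its average over the smaller trees, with a gain
whenever the subtree of the second vertex is large enough to send a car to the root. -/
theorem visitMean_succ_le {f : ℕ → ℝ} (hf : Antitone f) {M N n : ℕ} (hMN : M + N ≤ n) {s : ℝ}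
    (hs : ∀ k, N ≤ k → k ≤ n → s ≤ visitMean p k fun x => f x - f (x + 1)) :
    (n + 1) * visitMean p (n + 1) f ≤ ∑ k ∈ Finset.range (n + 1), visitMean p k f -
      visitTail p M 2 * s * (n + 1 - M - N) := by
  have hr := visitTail_nonneg hp0 hp1 M 2
  rw [visitMean_succ_eq_sum, Finset.Nat.sum_antidiagonal_eq_sum_range_succ (fun i j =>
    visitMean p i fun x => visitMean p j fun y => f (x + (y - 1)))]
  have hterm : ∀ k ∈ Finset.range n.succ,
      (visitMean p k fun x => visitMean p (n - k) fun y => f (x + (y - 1))) ≤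
        visitMean p k f - if k ∈ Finset.Ico N (n + 1 - M) then visitTail p M 2 * s else 0 := by
    intro k hk
    split_ifs with hk2
    · rw [Finset.mem_Ico] at hk2
      calc _ ≤ visitMean p k fun x => f x - visitTail p M 2 * (f x - f (x + 1)) :=
            visitMean_mono hp0 hp1 k fun x => visitMean_flux_le hp0 hp1 hf (by omega) x
        _ = visitMean p k f - visitTail p M 2 * visitMean p k fun x => f x - f (x + 1) := by
            rw [visitMean_sub, visitMean_const_mul]
        _ ≤ _ := sub_le_sub_left
            (mul_le_mul_of_nonneg_left (hs k hk2.1 (by omega)) hr) _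
    · rw [sub_zero]
      refine visitMean_mono hp0 hp1 k fun x => ?_
      calc _ ≤ visitMean p (n - k) fun _ => f x :=
            visitMean_mono hp0 hp1 _ fun y => hf (Nat.le_add_right _ _)
        _ = f x := visitMean_const _ _ _
  refine (Finset.sum_le_sum hterm).trans (le_of_eq ?_)
  rw [Finset.sum_sub_distrib, Finset.sum_ite_mem, Finset.inter_eq_right.mpr, Finset.sum_const,
    Nat.card_Ico, nsmul_eq_mul, Nat.cast_sub (by omega), Nat.cast_sub (by omega)]
  · push_cast
    ring
  · intro k hk
    rw [Finset.mem_Ico] at hk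
    rw [Finset.mem_range]
    omega

/-- The drift inequality, integrated over the sizes `4 N + 1, …, n + 1`. -/
theorem visitMean_le_one_sub {f : ℕ → ℝ} (hf : Antitone f) (hf1 : ∀ x, f x ≤ 1) {M N n : ℕ}
    (hN : 1 ≤ N) (hMN : M ≤ N) (hn : 4 * N ≤ n) {s : ℝ} (hs0 : 0 ≤ s)
    (hs : ∀ k, N ≤ k → k ≤ n → s ≤ visitMean p k fun x => f x - f (x + 1)) :
    visitMean p n f ≤ 1 - visitTail p M 2 * s / 2 * Real.log ((n + 1) / (4 * N + 1)) := by
  have hr := visitTail_nonneg hp0 hp1 M 2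
  set c := visitTail p M 2 * s / 2 with hc
  have hc0 : 0 ≤ c := by positivity
  set S : ℕ → ℝ := fun m => ∑ k ∈ Finset.range m, visitMean p k f with hS
  have hg : ∀ m, 4 * N ≤ m → m ≤ n → m * visitMean p m f ≤ S m - c * m := by
    intro m h4 hm
    obtain ⟨m, rfl⟩ : ∃ k, m = k + 1 := ⟨m - 1, by omega⟩
    have h := visitMean_succ_le hp0 hp1 hf (M := M) (N := N) (n := m) (by omega)
      (fun k h1 h2 => hs k h1 (by omega))
    have h4' : (4 : ℝ) * N ≤ m + 1 := by exact_mod_cast h4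
    have hMN' : (M : ℝ) ≤ N := by exact_mod_cast hMN
    have h5 : c * (m + 1) ≤ visitTail p M 2 * s * (m + 1 - M - N) := by
      rw [hc, div_mul_eq_mul_div, mul_div_assoc]
      refine mul_le_mul_of_nonneg_left ?_ (by positivity)
      linarith
    push_cast
    simp only [hS]
    linarith
  have hA : ∀ m, 4 * N ≤ m → m ≤ n →
      S m ≤ m * (1 - c * Real.log ((m + 1) / (4 * N + 1))) := by
    intro m h4
    induction m, h4 using Nat.le_induction with
    | base =>
      intro _
      have h1 : S (4 * N) ≤ ∑ k ∈ Finset.range (4 * N), (1 : ℝ) :=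
        Finset.sum_le_sum fun k _ =>
          (visitMean_mono hp0 hp1 k hf1).trans_eq (visitMean_const p k 1)
      rw [Finset.sum_const, Finset.card_range, nsmul_eq_mul] at h1
      have h2 : ((4 * N : ℕ) + 1 : ℝ) / (4 * N + 1) = 1 := by
        push_cast
        exact div_self (by positivity)
      rw [h2, Real.log_one, mul_zero, sub_zero]
      exact h1
    | succ m h4 ih =>
      intro hm
      have hm0 : (0 : ℝ) < m := by exact_mod_cast (by omega : 0 < m)
      have h1 := ih (by omega)
      have h2 := hg m h4 (by omega)
      have h3 : S (m + 1) = S m + visitMean p m f := Finset.sum_range_succ _ _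
      have hlog : Real.log (((m + 1 : ℕ) + 1) / (4 * N + 1)) ≤
          Real.log ((m + 1) / (4 * N + 1)) + 1 / (m + 1) := by
        have h5 : (((m + 1 : ℕ) : ℝ) + 1) / (4 * N + 1) =
            ((m + 1) / (4 * N + 1)) * (1 + 1 / (m + 1)) := by
          push_cast
          field_simp
        rw [h5, Real.log_mul (by positivity) (by positivity)]
        have := Real.log_le_sub_one_of_pos (by positivity : (0 : ℝ) < 1 + 1 / (m + 1))
        linarith
      set l := Real.log ((m + 1) / (4 * N + 1)) with hl
      have h6 : visitMean p m f ≤ 1 - c * l - c := by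
        refine le_of_mul_le_mul_left ?_ hm0
        linarith
      calc S (m + 1) ≤ m * (1 - c * l) + (1 - c * l - c) := by linarith
        _ = (m + 1) * (1 - c * (l + 1 / (m + 1))) := by field_simp; ring
        _ ≤ (m + 1) * (1 - c * Real.log (((m + 1 : ℕ) + 1) / (4 * N + 1))) := by
            have := mul_le_mul_of_nonneg_left hlog hc0
            exact mul_le_mul_of_nonneg_left (by linarith) (by positivity)
        _ = _ := by push_cast; rfl
  have hn0 : (0 : ℝ) < n := by exact_mod_cast (by omega : 0 < n)
  refine le_of_mul_le_mul_left ?_ hn0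
  have := mul_nonneg hc0 hn0.le
  linarith [hg n hn le_rfl, hA n hn le_rfl]

/-- The drift inequality for the event that no car visits the root: its drift is proportional to its
probability, which only decreases with the size of the tree. -/
theorem visitTail_one_ge {M n : ℕ} (hM : 1 ≤ M) (hn : 4 * M ≤ n) :
    visitTail p M 2 / 2 * Real.log ((n + 1) / (4 * M + 1)) * (1 - visitTail p n 1) ≤
      visitTail p n 1 := by
  have h := visitMean_le_one_sub hp0 hp1 (antitone_ite_lt 1) (fun x => by split_ifs <;> norm_num)
    hM le_rfl hn (s := 1 - visitTail p n 1)
    (by rw [← visitMean_ite_lt]; exact visitMean_nonneg hp0 hp1 n fun x => by positivity)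
    (by
      intro k _ hk
      have h1 : visitTail p k 1 ≤ visitTail p n 1 := visitTail_mono hp0 hp1 1 hk
      have h2 : (fun x : ℕ => (if x < 1 then (1 : ℝ) else 0) - if x + 1 < 1 then 1 else 0) =
          fun x => if x < 1 then 1 else 0 := by
        funext x
        simp
      rw [h2, visitMean_ite_lt]
      linarith)
  rw [visitMean_ite_lt] at h
  linarith

/-- The drift inequality for the event that at most one car visits the root: its drift is proportional
to the probability of exactly one visit, which is close to `visitTail p N 1` as long as a second visit
is unlikely. -/
theorem visitTail_two_ge {M N n : ℕ} (hN : 1 ≤ N) (hMN : M ≤ N) (hn : 4 * N ≤ n) :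
    visitTail p M 2 / 2 * Real.log ((n + 1) / (4 * N + 1)) *
      (visitTail p N 1 - visitTail p n 2) ≤ visitTail p n 2 := by
  have hlog : 0 ≤ Real.log (((n : ℝ) + 1) / (4 * N + 1)) := by
    refine Real.log_nonneg ?_
    rw [one_le_div (by positivity)]
    have : (4 : ℝ) * N ≤ n := by exact_mod_cast hn
    linarith
  have hr := visitTail_nonneg hp0 hp1 M 2
  rcases le_or_gt (visitTail p N 1 - visitTail p n 2) 0 with h0 | h0
  · exact (mul_nonpos_of_nonneg_of_nonpos (by positivity) h0).trans
      (visitTail_nonneg hp0 hp1 n 2)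
  have h := visitMean_le_one_sub hp0 hp1 (antitone_ite_lt 2) (fun x => by split_ifs <;> norm_num)
    hN hMN hn h0.le
    (by
      intro k hk hk'
      have h1 : visitTail p N 1 ≤ visitTail p k 1 := visitTail_mono hp0 hp1 1 hk
      have h2 : visitTail p k 2 ≤ visitTail p n 2 := visitTail_mono hp0 hp1 2 hk'
      have h3 : (fun x : ℕ => (if x < 2 then (1 : ℝ) else 0) - if x + 1 < 2 then 1 else 0) =
          fun x => (if 1 ≤ x then 1 else 0) - if 2 ≤ x then 1 else 0 := by
        funext x
        split_ifs <;> first | omega | norm_num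
      rw [h3, visitMean_sub, ← visitTail, ← visitTail]
      linarith)
  rw [visitMean_ite_lt] at h
  linarith

/-- One step of the bootstrap. Between sizes separated by a factor `exp l`, the root gains about `l`
subtrees, each of which sends a car to it with probability at least `visitTail p M 2`. A first car thus
comes with probability at least `κ / (1 + κ)`, and a second one, in a next range of sizes, with
probability at least `κ / (1 + κ)` again. -/
theorem visitTail_two_ge_sq {M N n : ℕ} (hM : 1 ≤ M) (hMN : 4 * M ≤ N) (hn : 4 * N ≤ n) {l κ : ℝ}
    (hl1 : l ≤ Real.log ((N + 1) / (4 * M + 1))) (hl2 : l ≤ Real.log ((n + 1) / (4 * N + 1)))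
    (hκ0 : 0 ≤ κ) (hκ : κ ≤ visitTail p M 2 / 2 * l) :
    (κ / (1 + κ)) ^ 2 ≤ visitTail p n 2 := by
  have hr := visitTail_nonneg hp0 hp1 M 2
  have hκ1 : 0 < 1 + κ := by linarith
  -- solving `κ (u - v) ≤ v` for `v`
  have solve : ∀ u v a : ℝ, 0 ≤ v → κ ≤ a → a * (u - v) ≤ v → κ / (1 + κ) * u ≤ v := by
    intro u v a hv ha h
    rw [div_mul_eq_mul_div, div_le_iff₀ hκ1]
    rcases le_or_gt (u - v) 0 with h0 | h0
    · nlinarith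
    · nlinarith
  have h1 := solve 1 (visitTail p N 1) _ (visitTail_nonneg hp0 hp1 N 1)
    (hκ.trans (mul_le_mul_of_nonneg_left hl1 (by positivity)))
    (visitTail_one_ge hp0 hp1 hM hMN)
  have h2 := solve _ _ _ (visitTail_nonneg hp0 hp1 n 2)
    (hκ.trans (mul_le_mul_of_nonneg_left hl2 (by positivity)))
    (visitTail_two_ge hp0 hp1 (hM.trans (by omega)) (by omega : M ≤ N) hn)
  rw [mul_one] at h1
  calc (κ / (1 + κ)) ^ 2 = κ / (1 + κ) * (κ / (1 + κ)) := sq _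
    _ ≤ _ := (mul_le_mul_of_nonneg_left h1 (by positivity)).trans h2

theorem visitMean_half_pow_le {N n : ℕ} (hN : 1 ≤ N) (hn : 4 * N ≤ n) {κ : ℝ} (hκ0 : 0 ≤ κ)
    (hκ : κ ≤ visitTail p N 2 / 4 * Real.log ((n + 1) / (4 * N + 1))) :
    visitMean p n (fun x => (1 / 2 : ℝ) ^ x) ≤ 1 / (1 + κ) := by
  set g := visitMean p n (fun x => (1 / 2 : ℝ) ^ x) with hg
  have hanti : Antitone fun x : ℕ => (1 / 2 : ℝ) ^ x :=
    pow_right_anti₀ (by norm_num) (by norm_num)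
  have hg0 : 0 ≤ g := visitMean_nonneg hp0 hp1 n fun x => by positivity
  have h := visitMean_le_one_sub hp0 hp1 hanti (fun x => pow_le_one₀ (by norm_num) (by norm_num))
    hN le_rfl hn (s := 1 / 2 * g) (by positivity)
    (by
      intro k _ hk
      have h1 : g ≤ visitMean p k fun x => (1 / 2 : ℝ) ^ x := antitone_visitMean hp0 hp1 hanti hk
      have h2 : (fun x : ℕ => (1 / 2 : ℝ) ^ x - (1 / 2) ^ (x + 1)) =
          fun x => 1 / 2 * (1 / 2 : ℝ) ^ x := by
        funext x
        ring
      rw [h2, visitMean_const_mul]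
      linarith)
  rw [le_div_iff₀ (by linarith)]
  have := mul_le_mul_of_nonneg_right hκ hg0
  linarith

end

/-! ### Bootstrapping over polynomial scales -/

/-- In recursive trees of any size that is at least a fixed power of `n`, two cars visit the root
with probability at least a constant times `log n ^ β`. -/
def TwoVisitsAtRate (p : ℕ → ℝ) (β : ℝ) : Prop :=
  ∀ η : ℝ, 0 < η → ∃ c : ℝ, 0 < c ∧ ∀ᶠ n : ℕ in atTop, ∀ m : ℕ, (n : ℝ) ^ η ≤ m →
    c * Real.log n ^ β ≤ visitTail (p n) m 2

theorem tendsto_log_natCast_atTop : Tendsto (fun n : ℕ => Real.log n) atTop atTop :=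
  Real.tendsto_log_atTop.comp tendsto_natCast_atTop_atTop

theorem TwoVisitsAtRate.mono {p : ℕ → ℝ} {β γ : ℝ} (h : TwoVisitsAtRate p β) (hγ : γ ≤ β) :
    TwoVisitsAtRate p γ := by
  intro η hη
  obtain ⟨c, hc, h⟩ := h η hη
  refine ⟨c, hc, ?_⟩
  filter_upwards [h, tendsto_log_natCast_atTop.eventually_ge_atTop 1] with n hn hL m hm
  exact (mul_le_mul_of_nonneg_left (Real.rpow_le_rpow_of_exponent_le hL hγ) hc.le).trans (hn m hm)

/-- The sizes `x ^ 2`, rounded up, and `x ^ 4` are separated by a factor `x`, with enough room for the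
constants of the drift inequality. -/
theorem scales_separated {x : ℝ} (hx : 9 ≤ x) {N : ℕ} (hN : N = ⌈x ^ 2⌉₊) {n : ℕ}
    (hn : x ^ 4 ≤ n + 1) :
    4 * N ≤ n ∧ Real.log x ≤ Real.log ((n + 1) / (4 * N + 1)) := by
  have h1 : (N : ℝ) < x ^ 2 + 1 := by
    rw [hN]
    exact Nat.ceil_lt_add_one (by positivity)
  have h2 : (81 : ℝ) ≤ x ^ 2 := by nlinarith
  have h4 : x ^ 4 = x ^ 2 * x ^ 2 := by ring
  have h5 : (4 : ℝ) * N + 1 ≤ 9 * x ^ 2 := by nlinarith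
  constructor
  · have : (4 : ℝ) * N ≤ n := by nlinarith
    exact_mod_cast this
  · refine Real.log_le_log (by linarith) ?_
    rw [le_div_iff₀ (by positivity)]
    nlinarith [mul_le_mul_of_nonneg_left h5 (by linarith : 0 ≤ x)]

/-- The rate `log n ^ β` improves to its square, up to a factor `log n ^ 2`, as long as it does not
exceed a constant. -/
theorem TwoVisitsAtRate.improve {p : ℕ → ℝ} {β : ℝ} (hp : ∀ᶠ n in atTop, 0 ≤ p n ∧ p n ≤ 1)
    (h : TwoVisitsAtRate p β) : TwoVisitsAtRate p (2 * min (β + 1) 0) := by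
  intro η hη
  obtain ⟨c, hc, h⟩ := h (η / 4) (by positivity)
  set d := c * η / 16 with hd
  have hd0 : 0 < d := by positivity
  refine ⟨(d / (1 + d)) ^ 2, by positivity, ?_⟩
  have hx9 : ∀ᶠ n : ℕ in atTop, 9 ≤ (n : ℝ) ^ (η / 8) :=
    ((tendsto_rpow_atTop (by positivity : 0 < η / 8)).comp
      tendsto_natCast_atTop_atTop).eventually_ge_atTop 9
  filter_upwards [h, hp, hx9, tendsto_log_natCast_atTop.eventually_ge_atTop 1,
    eventually_ge_atTop 1] with n hn hpn hx hL hn1 m hm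
  set x := (n : ℝ) ^ (η / 8) with hxdef
  set L := Real.log n with hLdef
  have hn0 : (0 : ℝ) < n := by exact_mod_cast hn1
  have hL0 : 0 < L := by linarith
  have hpow : ∀ k : ℕ, x ^ k = (n : ℝ) ^ (η / 8 * k) := fun k => by
    rw [hxdef, ← Real.rpow_natCast, ← Real.rpow_mul hn0.le]
  have hlogx : Real.log x = η / 8 * L := Real.log_rpow hn0 _
  set M := ⌈x ^ 2⌉₊ with hM
  set N := ⌈(x ^ 2) ^ 2⌉₊ with hN
  have hN4 : x ^ 4 ≤ N := (by ring : x ^ 4 = (x ^ 2) ^ 2).trans_le (Nat.le_ceil _)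
  obtain ⟨hMN, hl1⟩ := scales_separated hx hM (n := N) (by linarith)
  obtain ⟨hNm, hl2⟩ := scales_separated (x := x ^ 2) (by nlinarith) hN (n := m) (by
    have : x ^ 8 ≤ m := by
      rw [hpow]
      refine le_trans (le_of_eq ?_) hm
      congr 1
      push_cast
      ring
    calc (x ^ 2) ^ 4 = x ^ 8 := by ring
      _ ≤ (m : ℝ) + 1 := by linarith)
  have hM1 : 1 ≤ M := Nat.one_le_ceil_iff.mpr (by positivity)
  have hlx : Real.log x ≤ Real.log (x ^ 2) := Real.log_le_log (by linarith) (by nlinarith)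
  have hrM := hn M (by
    refine le_trans (le_of_eq ?_) (Nat.le_ceil _)
    rw [hpow]
    congr 1
    push_cast
    ring)
  set b := min (β + 1) 0 with hb
  have hLb0 : 0 < L ^ b := Real.rpow_pos_of_pos hL0 b
  have hLb1 : L ^ b ≤ 1 := Real.rpow_le_one_of_one_le_of_nonpos hL (min_le_right _ _)
  have hκ : d * L ^ b ≤ visitTail (p n) M 2 / 2 * Real.log x := by
    calc d * L ^ b ≤ d * L ^ (β + 1) := mul_le_mul_of_nonneg_left
          (Real.rpow_le_rpow_of_exponent_le hL (min_le_left _ _)) hd0.le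
      _ = c * L ^ β / 2 * (η / 8 * L) := by
          rw [Real.rpow_add_one hL0.ne', hd]
          ring
      _ ≤ _ := by
          rw [hlogx]
          exact mul_le_mul_of_nonneg_right (by linarith) (by positivity)
  refine le_trans ?_ (visitTail_two_ge_sq hpn.1 hpn.2 hM1 hMN hNm hl1 (hlx.trans hl2)
    (by positivity) hκ)
  rw [two_mul, Real.rpow_add hL0, ← sq, ← mul_pow]
  refine pow_le_pow_left₀ (by positivity) ?_ 2
  rw [div_mul_eq_mul_div]
  refine div_le_div_of_nonneg_left (by positivity) (by positivity) ?_
  nlinarith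

/-- If `p n` exceeds `log n ^ (-2 + δ)`, finitely many improvements reach a constant rate. -/
theorem twoVisitsAtRate_zero {p : ℕ → ℝ} {δ : ℝ} (hδ : 0 < δ)
    (hp : ∀ᶠ n in atTop, 0 ≤ p n ∧ p n ≤ 1) {c : ℝ} (hc : 0 < c)
    (h : ∀ᶠ n : ℕ in atTop, c * Real.log n ^ (-2 + δ) ≤ p n) : TwoVisitsAtRate p 0 := by
  have hbase : TwoVisitsAtRate p (-2 + δ) := by
    intro η _
    refine ⟨c, hc, ?_⟩
    filter_upwards [h, hp] with n hn hpn m _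
    exact hn.trans (le_visitTail_two hpn.1 hpn.2 m)
  have hind : ∀ j : ℕ, TwoVisitsAtRate p (min (-2 + (j + 1) * δ) 0) := by
    intro j
    induction j with
    | zero => exact hbase.mono ((min_le_left _ _).trans (by simp))
    | succ j ih =>
      refine (ih.improve hp).mono ?_
      push_cast
      have hj : 0 ≤ (j : ℝ) * δ := by positivity
      rcases le_total (-2 + ((j : ℝ) + 1) * δ) 0 with h0 | h0
      · rw [min_eq_left h0]
        rcases le_total (-2 + ((j : ℝ) + 1) * δ + 1) 0 with h1 | h1
        · rw [min_eq_left h1]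
          exact (min_le_left _ _).trans (by linarith)
        · rw [min_eq_right h1, mul_zero]
          exact min_le_right _ _
      · rw [min_eq_right h0, zero_add, min_eq_right zero_le_one, mul_zero]
        exact min_le_right _ _
  obtain ⟨j, hj⟩ := exists_nat_ge (2 / δ)
  have h2 := hind j
  rw [div_le_iff₀ hδ] at hj
  rwa [min_eq_right (by linarith)] at h2

/-- At a constant rate, the number of visits tends to infinity in probability: there are of the order
of `log n` large subtrees at the root, so that the Laplace transform of that number at `log 2` is
`O(1 / log n)`. -/
theorem tendsto_visitMean_half_pow {p : ℕ → ℝ} (hp : ∀ᶠ n in atTop, 0 ≤ p n ∧ p n ≤ 1)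
    (h : TwoVisitsAtRate p 0) :
    Tendsto (fun n => visitMean (p n) (n - 1) fun x => (1 / 2 : ℝ) ^ x) atTop (𝓝 0) := by
  obtain ⟨c, hc, h⟩ := h (1 / 2) (by norm_num)
  have hlim : Tendsto (fun n : ℕ => 1 / (1 + c / 16 * Real.log n)) atTop (𝓝 0) := by
    simp only [one_div]
    exact (tendsto_atTop_add_const_left _ _
      (tendsto_log_natCast_atTop.const_mul_atTop (by positivity))).inv_tendsto_atTop
  have hx9 : ∀ᶠ n : ℕ in atTop, 9 ≤ (n : ℝ) ^ (1 / 4 : ℝ) :=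
    ((tendsto_rpow_atTop (by norm_num : (0 : ℝ) < 1 / 4)).comp
      tendsto_natCast_atTop_atTop).eventually_ge_atTop 9
  refine squeeze_zero' ?_ ?_ hlim
  · filter_upwards [hp] with n hpn
    exact visitMean_nonneg hpn.1 hpn.2 _ fun x => by positivity
  · filter_upwards [h, hp, hx9, tendsto_log_natCast_atTop.eventually_ge_atTop 1,
      eventually_ge_atTop 1] with n hn hpn hx hL hn1
    set x := (n : ℝ) ^ (1 / 4 : ℝ) with hxdef
    have hn0 : (0 : ℝ) < n := by exact_mod_cast hn1
    have hpow : ∀ k : ℕ, x ^ k = (n : ℝ) ^ (1 / 4 * k : ℝ) := fun k => by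
      rw [hxdef, ← Real.rpow_natCast, ← Real.rpow_mul hn0.le]
    have hlogx : Real.log x = 1 / 4 * Real.log n := Real.log_rpow hn0 _
    have h4 : x ^ 4 = ((n - 1 : ℕ) : ℝ) + 1 := by
      rw [hpow, Nat.cast_sub hn1]
      norm_num
    obtain ⟨hN, hl⟩ := scales_separated hx rfl h4.le
    have hr := hn ⌈x ^ 2⌉₊ (by
      refine le_trans (le_of_eq ?_) (Nat.le_ceil _)
      rw [hpow]
      norm_num)
    rw [Real.rpow_zero, mul_one] at hr
    refine visitMean_half_pow_le hpn.1 hpn.2 (Nat.one_le_ceil_iff.mpr (by positivity)) hN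
      (by positivity) ?_
    calc c / 16 * Real.log n = c / 4 * (1 / 4 * Real.log n) := by ring
      _ ≤ _ := by
        refine mul_le_mul (by linarith) (hlogx ▸ hl) (by positivity) ?_
        linarith

/-! ### The two regimes of the flux -/

theorem measure_flux_mem {Ω : Type*} [MeasurableSpace Ω] {P : Measure Ω} {n : ℕ} (hn : 1 ≤ n)
    {α : ℝ} (hα : α ∈ Set.Icc (0 : ℝ) 1) {T : Ω → RecursiveTree n} {A : Ω → Fin n → ℕ}
    (h : HasLaw (fun ω => (T ω, A ω)) (parkingLaw n (binaryLaw α)) P) (B : Set ℕ) :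
    P {ω | flux (T ω) (A ω) ∈ B} =
      ENNReal.ofReal (visitMean (α / 2) (n - 1) fun x => B.indicator 1 (x - 1)) := by
  obtain ⟨n, rfl⟩ : ∃ k, n = k + 1 := ⟨n - 1, by omega⟩
  rw [Nat.add_sub_cancel, ← parkingLaw_flux_mem hα.1 hα.2, ← h.map_eq,
    Measure.map_apply_of_aemeasurable h.aemeasurable MeasurableSet.of_discrete]
  rfl

end RecursiveParking

theorem mainTheorem3 {Ω : Type*} [MeasurableSpace Ω] (P : Measure Ω) [IsProbabilityMeasure P]
    (δ : ℝ) (hδ : 0 < δ)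
    (α : ℕ → ℝ) (hα : ∀ n, 1 ≤ n → α n ∈ Set.Icc (0 : ℝ) 1)
    (T : (n : ℕ) → Ω → RecursiveParking.RecursiveTree n)
    (A : (n : ℕ) → Ω → Fin n → ℕ)
    (hTA : ∀ n, 1 ≤ n → HasLaw (fun ω => (T n ω, A n ω))
      (RecursiveParking.parkingLaw n (RecursiveParking.binaryLaw (α n))) P) :
    (α =o[atTop] (fun n : ℕ => Real.log n ^ (-2 : ℝ)) →
      TendstoInMeasure P (fun n ω => (RecursiveParking.flux (T n ω) (A n ω) : ℝ)) atTop
        (fun _ => 0)) ∧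
    ((fun n : ℕ => Real.log n ^ (-2 + δ)) =o[atTop] α →
      ∀ C : ℝ, Tendsto (fun n => P {ω | C ≤ (RecursiveParking.flux (T n ω) (A n ω) : ℝ)}) atTop
        (𝓝 1)) := by
  have hp : ∀ᶠ n in atTop, 0 ≤ α n / 2 ∧ α n / 2 ≤ 1 := by
    filter_upwards [eventually_ge_atTop 1] with n hn
    have := hα n hn
    exact ⟨by linarith [this.1], by linarith [this.2]⟩
  constructor
  · intro ho ε hε
    have hsmall : Tendsto (fun n : ℕ => α n / 2 * Real.log n ^ 2 * Real.exp 3) atTop (𝓝 0) := by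
      have h1 := (ho.tendsto_div_nhds_zero.mul_const (1 / 2 * Real.exp 3))
      rw [zero_mul] at h1
      refine h1.congr' ?_
      filter_upwards [RecursiveParking.tendsto_log_natCast_atTop.eventually_ge_atTop 1] with n hL
      have hL0 : 0 ≤ Real.log n := by linarith
      rw [Real.rpow_neg hL0, Real.rpow_two, div_inv_eq_mul]
      ring
    have hlim := ENNReal.tendsto_ofReal hsmall
    rw [ENNReal.ofReal_zero] at hlim
    refine tendsto_of_tendsto_of_tendsto_of_le_of_le' tendsto_const_nhds hlim
      (Eventually.of_forall fun n => zero_le) ?_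
    filter_upwards [hp, eventually_ge_atTop 1, hsmall.eventually_le_const zero_lt_one,
      RecursiveParking.tendsto_log_natCast_atTop.eventually_ge_atTop 2] with n hpn hn hle hL
    have hcast : (((n - 1 : ℕ) : ℝ) + 1) = n := by
      rw [Nat.cast_sub hn]
      norm_num
    have hup := RecursiveParking.visitMean_two_le_upper hpn.1 hpn.2 (n := n - 1)
      (by rwa [hcast]) (by rwa [hcast])
    rw [hcast] at hup
    calc P {ω | ε ≤ edist (RecursiveParking.flux (T n ω) (A n ω) : ℝ) 0}
        ≤ P {ω | RecursiveParking.flux (T n ω) (A n ω) ∈ ({0}ᶜ : Set ℕ)} := by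
          refine measure_mono fun ω hω h0 => ?_
          rw [Set.mem_singleton_iff] at h0
          simp only [Set.mem_ofPred_eq, h0, Nat.cast_zero, edist_self] at hω
          exact absurd hε (not_lt.mpr hω)
      _ ≤ _ := by
          rw [RecursiveParking.measure_flux_mem hn (hα n hn) (hTA n hn)]
          refine ENNReal.ofReal_le_ofReal (le_trans (le_of_eq ?_) hup)
          congr 1
          funext x
          by_cases hx : 2 ≤ x
          · have : x - 1 ≠ 0 := by omega
            simp [hx, this]
          · have : x - 1 = 0 := by omega
            simp [hx, this]
  · intro ho C
    have hrate : RecursiveParking.TwoVisitsAtRate (fun n => α n / 2) 0 := by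
      refine RecursiveParking.twoVisitsAtRate_zero hδ hp (c := 1 / 2) (by norm_num) ?_
      filter_upwards [ho.bound one_pos, hp,
        RecursiveParking.tendsto_log_natCast_atTop.eventually_ge_atTop 1] with n hn hpn hL
      rw [Real.norm_of_nonneg (Real.rpow_nonneg (by linarith) _),
        Real.norm_of_nonneg (by linarith [hpn.1])] at hn
      linarith
    have hzero := RecursiveParking.tendsto_visitMean_half_pow hp hrate
    obtain ⟨K, hK⟩ := exists_nat_ge C
    have hlim : Tendsto (fun n => ENNReal.ofReal (1 - 2 ^ K *
        RecursiveParking.visitMean (α n / 2) (n - 1) fun x => (1 / 2 : ℝ) ^ x)) atTop (𝓝 1) := by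
      have h1 := ENNReal.tendsto_ofReal ((hzero.const_mul ((2 : ℝ) ^ K)).const_sub 1)
      simpa using h1
    refine tendsto_of_tendsto_of_tendsto_of_le_of_le' hlim tendsto_const_nhds ?_
      (Eventually.of_forall fun n => prob_le_one)
    filter_upwards [hp, eventually_ge_atTop 1] with n hpn hn
    have hset : {ω | C ≤ (RecursiveParking.flux (T n ω) (A n ω) : ℝ)} =
        {ω | RecursiveParking.flux (T n ω) (A n ω) ∈ {k : ℕ | C ≤ (k : ℝ)}} := rfl
    rw [hset, RecursiveParking.measure_flux_mem hn (hα n hn) (hTA n hn)]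
    refine ENNReal.ofReal_le_ofReal ?_
    rw [← RecursiveParking.visitMean_const_mul]
    conv_lhs => rw [← RecursiveParking.visitMean_const (α n / 2) (n - 1) 1]
    rw [← RecursiveParking.visitMean_sub]
    refine RecursiveParking.visitMean_mono hpn.1 hpn.2 _ fun x => ?_
    rw [RecursiveParking.visitMean_const]
    by_cases hx : C ≤ ((x - 1 : ℕ) : ℝ)
    · have : (0 : ℝ) ≤ 2 ^ K * (1 / 2) ^ x := by positivity
      simp only [Set.indicator, Set.mem_ofPred_eq, hx, if_true, Pi.one_apply]
      linarith
    · have hxK : x ≤ K := by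
        have : ((x - 1 : ℕ) : ℝ) < K := (not_le.mp hx).trans_le hK
        have : x - 1 < K := by exact_mod_cast this
        omega
      have : (1 : ℝ) ≤ 2 ^ K * (1 / 2) ^ x := by
        rw [one_div, inv_pow, ← div_eq_mul_inv, one_le_div (by positivity)]
        exact pow_le_pow_right₀ (by norm_num) hxK
      simp only [Set.indicator, Set.mem_ofPred_eq, hx, if_false]
      linarith
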